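/- **Setting.** Let $\mathcal M=(\mathcal S,\mathcal A,r,c,P,\rho)$ be a finite constrained Markov decision process with $r:\mathcal S\times\mathcal A\to[0,1]$, $c:\mathcal S\times\mathcal A\to[-1,1]$, transition law $P$ and initial distribution $\rho$, such that under every policy the induced Markov chain on $\mathcal S$ is irreducible and aperiodic. Let $\{\pi_\theta\}_{\theta\in\mathbb R^d}$ be a class of policies, $\Theta\subseteq\mathbb R^d$, and let $\phi_g:\mathcal S\to\mathbb R^m$, $\|\phi_g(s)\|\le 1$, be feature maps, $g\in\{r,c\}$. Let $P^{\pi_\theta}(s,s')=\sum_a\pi_\theta(a|s)P(s'|s,a)$, let $d^{\pi_\theta}$ be its stationary distribution, and let $\mathbb E_\theta$ be the expectation over $z=(s,a,s')$ with $s\sim d^{\pi_\theta}$, $a\sim\pi_\theta(\cdot|s)$, $s'\sim P(\cdot|s,a)$. Let $\tau_{\mathrm{mix}}=\sup_{\theta\in\Theta}\min\{t\ge1:\ \|(P^{\pi_\theta})^t(s,\cdot)-d^{\pi_\theta}\|_{\mathrm{TV}}\le\frac14\ \forall s\}$. Assume that, for some $\lambda>0$, $\mathbb E_\theta[\phi_g(s)(\phi_g(s)-\phi_g(s'))^\top]-\lambda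 I$ is positive semidefinite (as a quadratic form) for all $\theta\in\Theta$, $g\in\{r,c\}$. For a constant $c_\gamma$ put $$\mathbf A_g(z)=\begin{pmatrix}c_\gamma&0\\ \phi_g(s)&\phi_g(s)(\phi_g(s)-\phi_g(s'))^\top\end{pmatrix},\qquad \mathbf b_g(z)=\begin{pmatrix}c_\gamma\, g(s,a)\\ g(s,a)\phi_g(s)\end{pmatrix},$$ $\mathbf A_g(\theta)=\mathbb E_\theta[\mathbf A_g(z)]$, $\mathbf b_g(\theta)=\mathbb E_\theta[\mathbf b_g(z)]$ and $\xi_g^*(\theta)=\mathbf A_g(\theta)^{-1}\mathbf b_g(\theta)\in\mathbb R^{1+m}$. **Algorithm.** For a function $f$ of transitions, an *MLMC estimate* of $f$ draws $Q\sim\mathrm{Geom}(1/2)$ on $\{1,2,\dots\}$ and then, from the current state, a $\pi_{\theta_k}$-trajectory $z^0,z^1,\dots$ of length $2^Q$ if $2^Q\le T_{\max}$ and of length $1$ otherwise; it is $f^0+2^Q(f^Q-f^{Q-1})\mathbf 1\{2^Q\le T_{\max}\}$ with $f^j=2^{-j}\sum_{t<2^j}f(z^t)$. The last state of the trajectory is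 the next current state; the first one is drawn from $\rho$. The primal-dual natural actor-critic algorithm starts from some $\theta_0$ and from $\lambda_0=0$, and runs $K$ epochs. Epoch $k$ consists of: 1. (critic) $H$ steps $\xi_{g,h+1}^k=\xi_{g,h}^k-\gamma_\xi v_{g,h}$ from $\xi_{g,0}^k=0$, $v_{g,h}$ being the MLMC estimate of $\mathbf A_g(z)\xi_{g,h}^k-\mathbf b_g(z)$ (the same trajectory for $g=r,c$); its output is $\xi_g^k=\xi_{g,H}^k=[\eta_g^k,\zeta_g^k]$; 2. (actor) $H$ steps $\omega_{g,h+1}^k=\omega_{g,h}^k-\gamma_\omega u_{g,h}$ from $\omega_{g,0}^k=0$, $u_{g,h}$ being the MLMC estimate of $\nabla\log\pi_{\theta_k}(a|s)\big(\langle\nabla\log\pi_{\theta_k}(a|s),\omega_{g,h}^k\rangle-[g(s,a)-\eta_g^k+\langle\zeta_g^k,\phi_g(s')-\phi_g(s)\rangle]\big)$; its output is $\omega_g^k=\omega_{g,H}^k$; 3. $\theta_{k+1}=\theta_k+\alpha(\omega_r^k+\lambda_k\omega_c^k)$, and $\lambda_{k+1}$ is the projection of $\lambda_k-\beta\eta_c^k$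 onto $[0,2/\delta]$, where $\delta\in(0,1)$. Assume that $\theta_k\in\Theta$ almost surely for all $k<K$, and let $\mathbb E_k$ be the conditional expectation given the history before epoch $k$. **Theorem.** There are universal constants $p\in\mathbb N$ and $\kappa$ such that for all $\lambda>0$ and all sufficiently large $c_\gamma$, namely $c_\gamma\ge\kappa(\lambda+1/\lambda)$, there is a constant $C>0$, depending only on $\lambda$ and $c_\gamma$, such that the following holds in every such setting, for all integers $K\ge 0$, $T,H\ge1$ and $T_{\max}$ and all values of the other inputs of the algorithm. If $$\gamma_\xi=\frac{2\log T}{\lambda H}\le\frac{\lambda}{24c_\gamma^2\tau_{\mathrm{mix}}\log T_{\max}},\qquad T_{\max}\ge\frac{8c_\gamma^2\tau_{\mathrm{mix}}}{\lambda},$$ then $\mathbf A_g(\theta)$ is invertible for $\theta\in\Theta$, $\xi_g^k$ and $\|\xi_g^k-\xi_g^*(\theta_k)\|^2$ are integrable, and, with $L=[(1+\log T)(1+\log T_{\max})]^p$, for both $g\in\{r,c\}$ and all $k\in\{0,\dots,K-1\}$, almost surely $$\big\|\mathbb E_k[\xi_g^k]-\xi_g^*(\theta_k)\big\|^2\le C\,L\left(\frac1{T^2}+\frac{\tau_{\mathrm{mix}}^2}{T_{\max}}\right),\qquad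 \mathbb E_k\big[\|\xi_g^k-\xi_g^*(\theta_k)\|^2\big]\le C\,L\left(\frac1{T^2}+\frac{\tau_{\mathrm{mix}}}{H}+\frac{\tau_{\mathrm{mix}}}{T_{\max}}\right).$$ -/

import Mathlib

open MeasureTheory ProbabilityTheory
open scoped Matrix

noncomputable section

namespace PDNAC

/-- The two scalar signals of a constrained MDP: the reward `r` and the constraint cost `c`. -/
inductive Signal where
  | r
  | c

/-- A constrained Markov decision process with reward `r : S × A → [0, 1]`, constraint cost
`c : S × A → [-1, 1]`, transition law `P` and initial state distribution `ρ`. -/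
structure CMDP (S A : Type*) where
  r : S → A → ℝ
  c : S → A → ℝ
  P : S → A → PMF S
  ρ : PMF S
  r_mem : ∀ s a, r s a ∈ Set.Icc (0 : ℝ) 1
  c_mem : ∀ s a, c s a ∈ Set.Icc (-1 : ℝ) 1

/-- A transition `z = (s, a, s')`. -/
abbrev Transition (S A : Type*) := S × A × S

/-- The space `ℝ ^ (1 + m)` of critic parameters `ξ = [η, ζ]`; the coordinate `Sum.inl ()` is the
average-reward estimate `η`, the coordinates `Sum.inr i` form the value-function weights `ζ`. -/
abbrev CriticSpace (m : ℕ) := EuclideanSpace ℝ (Unit ⊕ Fin m)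

/-- The space `ℝ ^ d` of policy parameters. -/
abbrev ParamSpace (d : ℕ) := EuclideanSpace ℝ (Fin d)

namespace CMDP

variable {S A : Type*} (M : CMDP S A)

/-- The signal `g ∈ {r, c}` as a function on state-action pairs. -/
def signal : Signal → S → A → ℝ
  | Signal.r => M.r
  | Signal.c => M.c

section Chain

variable [Fintype S] [Fintype A]

/-- The state transition matrix `P^π(s, s') = ∑ a, π(a | s) P(s' | s, a)`. -/
def transitionMatrix (π : S → PMF A) : Matrix S S ℝ :=
  Matrix.of fun s s' => ∑ a, (π s a).toReal * (M.P s a s').toReal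

/-- `q` is a stationary distribution of the chain induced by `π`. -/
def IsStationary (π : S → PMF A) (q : S → ℝ) : Prop :=
  (∀ s, 0 ≤ q s) ∧ ∑ s, q s = 1 ∧ q ᵥ* M.transitionMatrix π = q

/-- The stationary distribution `d^π`. It exists because `S` is finite, and it is unique when the
chain is irreducible. -/
def stationary (π : S → PMF A) : S → ℝ :=
  Classical.epsilon (M.IsStationary π)

/-- `E_π[f(z)]` for `z = (s, a, s')` with `s ∼ d^π`, `a ∼ π(s)`, `s' ∼ P(s, a)`. -/
def stationaryMean {V : Type*} [AddCommGroup V] [Module ℝ V] (π : S → PMF A)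
    (f : Transition S A → V) : V :=
  ∑ s, ∑ a, ∑ s', (M.stationary π s * (π s a).toReal * (M.P s a s').toReal) • f (s, a, s')

variable [DecidableEq S]

/-- Under every policy the induced chain on `S` is irreducible and aperiodic (no integer other
than `1` divides all the return times of a state). -/
def Ergodic : Prop :=
  ∀ π : S → PMF A, (M.transitionMatrix π).IsIrreducible ∧
    ∀ (s : S) (p : ℕ),
      (∀ n : ℕ, 1 ≤ n → 0 < (M.transitionMatrix π ^ n) s s → p ∣ n) → p = 1

/-- The mixing time of the chain induced by `π`: the least `t ≥ 1` such that the law at time `t`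
is within total variation distance `1/4` of `d^π`, for every initial state. -/
def mixingTime (π : S → PMF A) : ℕ :=
  sInf {t : ℕ | 1 ≤ t ∧
    ∀ s, (1 / 2 : ℝ) * ∑ s', |(M.transitionMatrix π ^ t) s s' - M.stationary π s'| ≤ 1 / 4}

/-- The overall mixing time `τ_mix`, the supremum of the mixing times over the parameter set. -/
def tauMix {d : ℕ} (π : ParamSpace d → S → PMF A) (Θ : Set (ParamSpace d)) : ℕ :=
  ⨆ θ : Θ, M.mixingTime (π θ)

end Chain

section Critic

variable {m : ℕ} (φ : Signal → S → EuclideanSpace ℝ (Fin m)) (cγ : ℝ)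

/-- The one-sample matrix `A_g(z)`, with blocks `c_γ`, `0`, `φ_g(s)` and
`φ_g(s) (φ_g(s) - φ_g(s'))ᵀ`. -/
def criticMatrixAt (g : Signal) (z : Transition S A) :
    Matrix (Unit ⊕ Fin m) (Unit ⊕ Fin m) ℝ :=
  Matrix.fromBlocks
    (Matrix.of fun _ _ => cγ) 0
    (Matrix.of fun i _ => φ g z.1 i)
    (Matrix.of fun i j => φ g z.1 i * (φ g z.1 j - φ g z.2.2 j))

/-- The one-sample vector `b_g(z) = [c_γ g(s, a), g(s, a) φ_g(s)]`. -/
def criticVectorAt (g : Signal) (z : Transition S A) : Unit ⊕ Fin m → ℝ :=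
  Sum.elim (fun _ => cγ * M.signal g z.1 z.2.1)
    (fun i => M.signal g z.1 z.2.1 * φ g z.1 i)

/-- The one-sample critic direction `v_g(ξ; z) = A_g(z) ξ - b_g(z)`. -/
def criticDirectionAt (g : Signal) (ξ : CriticSpace m) (z : Transition S A) : CriticSpace m :=
  WithLp.toLp 2
    (criticMatrixAt φ cγ g z *ᵥ (fun i => ξ i) - M.criticVectorAt φ cγ g z)

variable [Fintype S] [Fintype A]

/-- `A_g = E_π[A_g(z)]`. -/
def criticMatrix (π : S → PMF A) (g : Signal) : Matrix (Unit ⊕ Fin m) (Unit ⊕ Fin m) ℝ :=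
  M.stationaryMean π (criticMatrixAt φ cγ g)

/-- `b_g = E_π[b_g(z)]`. -/
def criticVector (π : S → PMF A) (g : Signal) : Unit ⊕ Fin m → ℝ :=
  M.stationaryMean π (M.criticVectorAt φ cγ g)

/-- The target `ξ_g^* = A_g⁻¹ b_g`. -/
def criticTarget (π : S → PMF A) (g : Signal) : CriticSpace m :=
  WithLp.toLp 2 ((M.criticMatrix φ cγ π g)⁻¹ *ᵥ M.criticVector φ cγ π g)

/-- `E_θ[φ_g(s) (φ_g(s) - φ_g(s'))ᵀ] - lam I` is positive semidefinite as a quadratic form (the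
matrix need not be symmetric), for all `θ ∈ Θ` and both signals. -/
def CriticPositive {d : ℕ} (π : ParamSpace d → S → PMF A) (Θ : Set (ParamSpace d))
    (lam : ℝ) : Prop :=
  ∀ θ ∈ Θ, ∀ (g : Signal) (x : Fin m → ℝ),
    0 ≤ x ⬝ᵥ ((M.stationaryMean (π θ) (fun z : Transition S A =>
        Matrix.vecMulVec (fun i => φ g z.1 i) (fun j => φ g z.1 j - φ g z.2.2 j))
      - lam • (1 : Matrix (Fin m) (Fin m) ℝ)) *ᵥ x)

end Critic

end CMDP

/-! ### Multi-level Monte Carlo sampling -/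

/-- The geometric law with parameter `1/2` on `{1, 2, 3, …}`. -/
def levelLaw : PMF ℕ :=
  (geometricMeasure ⟨1 / 2, by norm_num, by norm_num⟩).toPMF.map (· + 1)

/-- Length of the trajectory drawn at level `q`: `2 ^ q` if `2 ^ q ≤ T_max`, and `1` otherwise. -/
def trajLength (Tmax q : ℕ) : ℕ := if 2 ^ q ≤ Tmax then 2 ^ q else 1

/-- The average `2 ^ (-j) ∑_{t < 2 ^ j} f(z_t)`. -/
def levelMean {Z V : Type*} [AddCommGroup V] [Module ℝ V] (f : Z → V) (zs : List Z)
    (j : ℕ) : V :=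
  ((2 : ℝ) ^ j)⁻¹ • ((zs.take (2 ^ j)).map f).sum

/-- The multi-level Monte Carlo estimate from a trajectory `zs` drawn at level `q`. -/
def mlmc {Z V : Type*} [AddCommGroup V] [Module ℝ V] (Tmax : ℕ) (f : Z → V) (q : ℕ)
    (zs : List Z) : V :=
  levelMean f zs 0 +
    if 2 ^ q ≤ Tmax then (2 : ℝ) ^ q • (levelMean f zs q - levelMean f zs (q - 1)) else 0

/-- The data of one inner-loop step: the random level and the trajectory. -/
abbrev InnerSample (S A : Type*) := ℕ × List (Transition S A)

/-- The data of one epoch: the inner-loop steps of the critic, then those of the actor. -/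
abbrev EpochSample (S A : Type*) := List (InnerSample S A) × List (InnerSample S A)

/-- A run of the algorithm: the initial state and the data of the successive epochs. All iterates
are functions of a run. -/
def Run (S A : Type*) := S × List (EpochSample S A)

instance (S A : Type*) : MeasurableSpace (Run S A) := ⊤

/-- Last state of a trajectory that starts at `s`. -/
def trajEnd {S A : Type*} (s : S) (zs : List (Transition S A)) : S :=
  zs.foldl (fun _ z => z.2.2) s

/-- Last state of a succession of inner-loop steps that starts at `s`. -/
def innerEnd {S A : Type*} (s : S) (xs : List (InnerSample S A)) : S :=
  xs.foldl (fun s x => trajEnd s x.2) s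

/-- The law of the first `n` transitions from `s` under the policy `π`. -/
def CMDP.trajLaw {S A : Type*} (M : CMDP S A) (π : S → PMF A) :
    ℕ → S → PMF (List (Transition S A))
  | 0, _ => PMF.pure []
  | n + 1, s =>
      (π s).bind fun a => (M.P s a).bind fun s' =>
        (M.trajLaw π n s').map fun zs => (s, a, s') :: zs

/-- The law of `n` inner-loop steps: each draws a level and a trajectory that starts where the
previous trajectory ended. -/
def CMDP.innerLaw {S A : Type*} (M : CMDP S A) (π : S → PMF A) (Tmax : ℕ) :
    ℕ → S → PMF (List (InnerSample S A))
  | 0, _ => PMF.pure []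
  | n + 1, s =>
      levelLaw.bind fun q => (M.trajLaw π (trajLength Tmax q) s).bind fun zs =>
        (M.innerLaw π Tmax n (trajEnd s zs)).map fun xs => (q, zs) :: xs

/-! ### The primal-dual natural actor-critic algorithm -/

/-- The inputs of the algorithm besides the CMDP: policy class, critic features, initial
parameter, step sizes, the constant `c_γ`, Slater parameter `δ`, inner loop size `H`, `T_max`. -/
structure Algorithm (S A : Type*) (m d : ℕ) where
  π : ParamSpace d → S → PMF A
  φ : Signal → S → EuclideanSpace ℝ (Fin m)
  θ₀ : ParamSpace d
  α : ℝ
  β : ℝ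
  γω : ℝ
  γξ : ℝ
  cγ : ℝ
  δ : ℝ
  H : ℕ
  Tmax : ℕ

/-- What an epoch starts from: the primal and dual parameters and the current state. -/
structure EpochState (S : Type*) (d : ℕ) where
  θ : ParamSpace d
  dual : ℝ
  state : S

namespace Algorithm

variable {S A : Type*} {m d : ℕ} (alg : Algorithm S A m d) (M : CMDP S A)

/-- The critic parameter after the given inner-loop steps, starting from `0`:
`ξ_{h+1} = ξ_h - γ_ξ v_g(ξ_h)` with the MLMC estimate `v_g(ξ_h)`. -/
def criticIterate (g : Signal) (xs : List (InnerSample S A)) : CriticSpace m :=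
  xs.foldl (fun ξ x =>
    ξ - alg.γξ • mlmc alg.Tmax (M.criticDirectionAt alg.φ alg.cγ g ξ) x.1 x.2) 0

/-- The score `∇_θ log π_θ(a | s)`. -/
def score (θ : ParamSpace d) (s : S) (a : A) : ParamSpace d :=
  gradient (fun ϑ => Real.log (alg.π ϑ s a).toReal) θ

/-- The one-sample estimate of the gradient of the natural policy gradient objective,
`F(z) ω - [g(s, a) - η + ⟨ζ, φ_g(s') - φ_g(s)⟩] ∇ log π_θ(a | s)`. -/
def actorDirectionAt (g : Signal) (θ : ParamSpace d) (ξ : CriticSpace m) (w : ParamSpace d)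
    (z : Transition S A) : ParamSpace d :=
  inner ℝ (alg.score θ z.1 z.2.1) w • alg.score θ z.1 z.2.1 -
    (M.signal g z.1 z.2.1 - ξ (Sum.inl ()) +
      ∑ i, ξ (Sum.inr i) * (alg.φ g z.2.2 i - alg.φ g z.1 i)) • alg.score θ z.1 z.2.1

/-- The natural policy gradient estimate after the given inner-loop steps, starting from `0`. -/
def actorIterate (g : Signal) (θ : ParamSpace d) (ξ : CriticSpace m)
    (xs : List (InnerSample S A)) : ParamSpace d :=
  xs.foldl (fun w x =>
    w - alg.γω • mlmc alg.Tmax (alg.actorDirectionAt M g θ ξ w) x.1 x.2) 0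

/-- The update at the end of an epoch: `θ ← θ + α (ω_r + λ ω_c)` and
`λ ← Proj_{[0, 2/δ]} (λ - β η_c)`. -/
def epochUpdate (x : EpochState S d) (e : EpochSample S A) : EpochState S d where
  θ := x.θ + alg.α •
    (alg.actorIterate M Signal.r x.θ (alg.criticIterate M Signal.r e.1) e.2 +
      x.dual • alg.actorIterate M Signal.c x.θ (alg.criticIterate M Signal.c e.1) e.2)
  dual := max 0 (min (2 / alg.δ)
    (x.dual - alg.β * alg.criticIterate M Signal.c e.1 (Sum.inl ())))
  state := innerEnd (innerEnd x.state e.1) e.2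

/-- The epoch state reached after the given epochs, from `θ₀`, `λ₀ = 0` and the state `s`. -/
def stateAfter (s : S) (es : List (EpochSample S A)) : EpochState S d :=
  es.foldl (alg.epochUpdate M) ⟨alg.θ₀, 0, s⟩

/-- The law of the data of one epoch. -/
def epochLaw (x : EpochState S d) : PMF (EpochSample S A) :=
  (M.innerLaw (alg.π x.θ) alg.Tmax alg.H x.state).bind fun cs =>
    (M.innerLaw (alg.π x.θ) alg.Tmax alg.H (innerEnd x.state cs)).map fun as => (cs, as)

/-- The law of a run of `K` epochs. -/
def runLaw : ℕ → PMF (Run S A)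
  | 0 => M.ρ.map fun s => (s, [])
  | k + 1 => (runLaw k).bind fun ω =>
      (alg.epochLaw M (alg.stateAfter M ω.1 ω.2)).map fun e => (ω.1, ω.2 ++ [e])

/-- The probability measure on runs of `K` epochs. -/
def runMeasure (K : ℕ) : Measure (Run S A) := (alg.runLaw M K).toMeasure

/-- The policy parameter `θ_k` at the start of epoch `k`. -/
def theta (k : ℕ) (ω : Run S A) : ParamSpace d :=
  (alg.stateAfter M ω.1 (ω.2.take k)).θ

/-- The critic output `ξ_g^k` of epoch `k`. -/
def xi (g : Signal) (k : ℕ) (ω : Run S A) : CriticSpace m :=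
  alg.criticIterate M g (ω.2.getD k ([], [])).1

end Algorithm

/-- The history up to epoch `k`: the σ-algebra generated by the initial state and the data of
the epochs `0, …, k - 1`. -/
@[reducible]
def history (S A : Type*) (k : ℕ) : MeasurableSpace (Run S A) :=
  MeasurableSpace.comap (fun ω : Run S A => (ω.1, ω.2.take k)) ⊤

end PDNAC

end

/-!
Stacking `η` and `ζ`, the critic is a linear stochastic approximation scheme whose operator
`A_g(θ)` has coercivity constant at least `3 λ / 4`: the off-diagonal block `φ_g` is dominated by
`c_γ` and the value block through the AM-GM inequality. Its increments are Markovian. Every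
`τ_mix` steps of the chain halve the sup norm of a centred function, so that the trajectory
averages `f^j` have bias `O(τ_mix / 2 ^ j)` and mean square error `O(τ_mix / 2 ^ j)`. In the MLMC
estimate the weights `2 ^ Q` cancel the probabilities of the levels and the mean telescopes to that
of the longest average, while each of the at most `log₂ T_max` levels contributes `O(τ_mix)` to the
second moment. One inner step thus contracts the mean square error by the factor `1 - γ_ξ λ` up to
the squared bias and `γ_ξ ²` times the second moment, and `γ_ξ H = 2 log T / λ` turns the
contraction over `H` steps into `1 / T ^ 2`. The same recursion for the mean iterate carries no
variance term. These bounds hold from every initial state, hence conditionally on the history.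
-/

noncomputable section

namespace PDNAC

/-! ### Means of bounded functions under discrete laws -/

section Bounded

variable {α β V W : Type*} [NormedAddCommGroup V] [NormedAddCommGroup W]

/-- `f` is bounded on the support of `p`. -/
def BddOn (p : PMF α) (f : α → V) : Prop := ∃ C : ℝ, ∀ a ∈ p.support, ‖f a‖ ≤ C

lemma BddOn.of_forall {p : PMF α} {f : α → V} (C : ℝ) (h : ∀ a, ‖f a‖ ≤ C) : BddOn p f :=
  ⟨C, fun a _ => h a⟩

lemma BddOn.const (p : PMF α) (c : V) : BddOn p fun _ => c := ⟨‖c‖, fun _ _ => le_rfl⟩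

lemma BddOn.add {p : PMF α} {f g : α → V} (hf : BddOn p f) (hg : BddOn p g) :
    BddOn p fun a => f a + g a := by
  obtain ⟨C, hC⟩ := hf
  obtain ⟨D, hD⟩ := hg
  exact ⟨C + D, fun a ha => (norm_add_le _ _).trans (add_le_add (hC a ha) (hD a ha))⟩

lemma BddOn.sub {p : PMF α} {f g : α → V} (hf : BddOn p f) (hg : BddOn p g) :
    BddOn p fun a => f a - g a := by
  obtain ⟨C, hC⟩ := hf
  obtain ⟨D, hD⟩ := hg
  exact ⟨C + D, fun a ha => (norm_sub_le _ _).trans (add_le_add (hC a ha) (hD a ha))⟩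

lemma BddOn.norm_sq {p : PMF α} {f : α → V} (hf : BddOn p f) : BddOn p fun a => ‖f a‖ ^ 2 := by
  obtain ⟨C, hC⟩ := hf
  refine ⟨C ^ 2, fun a ha => ?_⟩
  rw [Real.norm_of_nonneg (sq_nonneg _)]
  exact pow_le_pow_left₀ (norm_nonneg _) (hC a ha) 2

lemma BddOn.indicator {p : PMF α} {f : α → V} (hf : BddOn p f) (s : Set α) :
    BddOn p (s.indicator f) := by
  obtain ⟨C, hC⟩ := hf
  exact ⟨C, fun a ha => (norm_indicator_le_norm_self _ _).trans (hC a ha)⟩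

lemma BddOn.of_bind {p : PMF α} {k : α → PMF β} {f : β → V} (h : BddOn (p.bind k) f)
    {a : α} (ha : a ∈ p.support) : BddOn (k a) f := by
  obtain ⟨C, hC⟩ := h
  exact ⟨C, fun b hb => hC b ((PMF.mem_support_bind_iff p k b).2 ⟨a, ha, hb⟩)⟩

lemma BddOn.of_map {p : PMF α} {k : α → β} {f : β → V} (h : BddOn (p.map k) f) :
    BddOn p fun a => f (k a) := by
  obtain ⟨C, hC⟩ := h
  exact ⟨C, fun a ha => hC _ ((PMF.mem_support_map_iff k p _).2 ⟨a, ha, rfl⟩)⟩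

lemma BddOn.map {p : PMF α} {k : α → β} {f : β → V} (h : BddOn p fun a => f (k a)) :
    BddOn (p.map k) f := by
  obtain ⟨C, hC⟩ := h
  refine ⟨C, fun b hb => ?_⟩
  obtain ⟨a, ha, rfl⟩ := (PMF.mem_support_map_iff k p _).1 hb
  exact hC a ha

lemma integrable_toMeasure [MeasurableSpace α] [DiscreteMeasurableSpace α]
    [SecondCountableTopology V] {p : PMF α} {f : α → V} (h : BddOn p f) :
    Integrable f p.toMeasure := by
  obtain ⟨C, hC⟩ := h
  borelize V
  refine Integrable.of_bound (C := C)
    (Measurable.of_discrete (f := f)).aestronglyMeasurable ?_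
  have : p.toMeasure p.supportᶜ = 0 := by
    rw [PMF.toMeasure_apply_eq_zero_iff _ (MeasurableSet.of_discrete)]
    exact disjoint_compl_right
  filter_upwards [compl_mem_ae_iff.2 this] with a ha
  exact hC a (by simpa using ha)

variable [NormedSpace ℝ V] [NormedSpace ℝ W]

lemma BddOn.const_smul {p : PMF α} {f : α → V} (c : ℝ) (hf : BddOn p f) :
    BddOn p fun a => c • f a := by
  obtain ⟨C, hC⟩ := hf
  refine ⟨|c| * C, fun a ha => ?_⟩
  rw [norm_smul]
  exact mul_le_mul_of_nonneg_left (hC a ha) (abs_nonneg c)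

lemma BddOn.const_mul {p : PMF α} {f : α → ℝ} (c : ℝ) (hf : BddOn p f) :
    BddOn p fun a => c * f a := hf.const_smul c

lemma BddOn.clm {p : PMF α} {f : α → V} (L : V →L[ℝ] W) (hf : BddOn p f) :
    BddOn p fun a => L (f a) := by
  obtain ⟨C, hC⟩ := hf
  exact ⟨‖L‖ * C, fun a ha => (L.le_opNorm _).trans
    (mul_le_mul_of_nonneg_left (hC a ha) (norm_nonneg _))⟩

end Bounded

section Mean

variable {α β V W : Type*} [NormedAddCommGroup V] [NormedSpace ℝ V]
  [NormedAddCommGroup W] [NormedSpace ℝ W]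

/-- The mean of `f` under the discrete law `p`. -/
def mean (p : PMF α) (f : α → V) : V := ∑' a, (p a).toReal • f a

lemma hasSum_toReal (p : PMF α) : HasSum (fun a => (p a).toReal) 1 := by
  have h : ∑' a, p a ≠ ⊤ := by simp [p.tsum_coe]
  have := ENNReal.hasSum_toReal h
  rwa [← ENNReal.tsum_toReal_eq (ENNReal.ne_top_of_tsum_ne_top h), p.tsum_coe,
    ENNReal.toReal_one] at this

lemma norm_toReal_smul_le {p : PMF α} {f : α → V} {C : ℝ} (h : ∀ a ∈ p.support, ‖f a‖ ≤ C)
    (a : α) : ‖(p a).toReal • f a‖ ≤ (p a).toReal * C := by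
  by_cases ha : p a = 0
  · simp [ha]
  · rw [norm_smul, Real.norm_of_nonneg ENNReal.toReal_nonneg]
    exact mul_le_mul_of_nonneg_left (h a ((p.mem_support_iff a).2 ha)) ENNReal.toReal_nonneg

lemma mean_congr {p : PMF α} {f g : α → V} (h : ∀ a ∈ p.support, f a = g a) :
    mean p f = mean p g := by
  refine tsum_congr fun a => ?_
  by_cases ha : p a = 0
  · simp [ha]
  · rw [h a ((p.mem_support_iff a).2 ha)]

lemma mean_pure (a : α) (f : α → V) : mean (PMF.pure a) f = f a := by
  rw [mean, tsum_eq_single a]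
  · simp
  · intro b hb
    simp [PMF.pure_apply, hb]

lemma mean_fintype [Fintype α] (p : PMF α) (f : α → V) : mean p f = ∑ a, (p a).toReal • f a :=
  tsum_fintype _

lemma norm_mean_le {p : PMF α} {f : α → V} {C : ℝ} (h : ∀ a ∈ p.support, ‖f a‖ ≤ C) :
    ‖mean p f‖ ≤ C := by
  have := tsum_of_norm_bounded ((hasSum_toReal p).mul_right C) (norm_toReal_smul_le h)
  rwa [one_mul] at this

lemma mean_const (p : PMF α) (c : V) : mean p (fun _ => c) = c := by
  have := (hasSum_toReal p).smul_const c
  rw [one_smul] at this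
  exact this.tsum_eq

lemma BddOn.summable [CompleteSpace V] {p : PMF α} {f : α → V} (h : BddOn p f) :
    Summable fun a => (p a).toReal • f a := by
  obtain ⟨C, hC⟩ := h
  exact Summable.of_norm_bounded ((hasSum_toReal p).summable.mul_right C)
    (norm_toReal_smul_le hC)

lemma BddOn.mean_bind {p : PMF α} {k : α → PMF β} {f : β → V} (h : BddOn (p.bind k) f) :
    BddOn p fun a => mean (k a) f := by
  obtain ⟨C, hC⟩ := h
  exact ⟨C, fun a ha => norm_mean_le fun b hb =>
    hC b ((PMF.mem_support_bind_iff p k b).2 ⟨a, ha, hb⟩)⟩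

lemma toReal_bind_smul (p : PMF α) (k : α → PMF β) (b : β) (v : V) :
    ((p.bind k) b).toReal • v = ∑' a, (p a * k a b).toReal • v := by
  have hb : ∑' a, p a * k a b ≠ ⊤ := by
    rw [← PMF.bind_apply]
    exact PMF.apply_ne_top _ _
  rw [PMF.bind_apply, ENNReal.tsum_toReal_eq (ENNReal.ne_top_of_tsum_ne_top hb)]
  exact ((ENNReal.summable_toReal hb).tsum_smul_const v).symm

variable [CompleteSpace V]

lemma mean_add {p : PMF α} {f g : α → V} (hf : BddOn p f) (hg : BddOn p g) :
    mean p (fun a => f a + g a) = mean p f + mean p g := by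
  simp only [mean, smul_add]
  exact hf.summable.tsum_add hg.summable

lemma mean_sub {p : PMF α} {f g : α → V} (hf : BddOn p f) (hg : BddOn p g) :
    mean p (fun a => f a - g a) = mean p f - mean p g := by
  simp only [mean, smul_sub]
  exact hf.summable.tsum_sub hg.summable

lemma mean_clm {p : PMF α} {f : α → V} (L : V →L[ℝ] W) (hf : BddOn p f) :
    mean p (fun a => L (f a)) = L (mean p f) := by
  simp only [mean]
  rw [L.map_tsum hf.summable]
  simp

lemma mean_smul {p : PMF α} {f : α → V} (c : ℝ) (hf : BddOn p f) :
    mean p (fun a => c • f a) = c • mean p f :=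
  mean_clm (c • ContinuousLinearMap.id ℝ V) hf

lemma mean_mul {p : PMF α} {f : α → ℝ} (c : ℝ) (hf : BddOn p f) :
    mean p (fun a => c * f a) = c * mean p f := mean_smul c hf

lemma mean_mono {p : PMF α} {f g : α → ℝ} (hf : BddOn p f) (hg : BddOn p g)
    (h : ∀ a ∈ p.support, f a ≤ g a) : mean p f ≤ mean p g := by
  refine hf.summable.tsum_le_tsum (fun a => ?_) hg.summable
  by_cases ha : p a = 0
  · simp [ha]
  · exact mul_le_mul_of_nonneg_left (h a ((p.mem_support_iff a).2 ha)) ENNReal.toReal_nonneg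

lemma mean_le {p : PMF α} {f : α → ℝ} {C : ℝ} (hf : BddOn p f)
    (h : ∀ a ∈ p.support, f a ≤ C) : mean p f ≤ C :=
  (mean_mono hf (BddOn.const p C) h).trans_eq (mean_const p C)

lemma summable_uncurry_bind {p : PMF α} {k : α → PMF β} {f : β → V} (h : BddOn (p.bind k) f) :
    Summable (Function.uncurry fun a b => (p a * k a b).toReal • f b) := by
  obtain ⟨C, hC⟩ := h
  have hsum : Summable fun x : α × β => (p x.1 * k x.1 x.2).toReal := by
    apply ENNReal.summable_toReal
    rw [ENNReal.tsum_prod']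
    simp [ENNReal.tsum_mul_left, PMF.tsum_coe]
  refine Summable.of_norm_bounded (hsum.mul_right C) fun ⟨a, b⟩ => ?_
  by_cases hab : p a * k a b = 0
  · rw [Function.uncurry_apply_pair, hab]
    simp
  · obtain ⟨ha, hb⟩ := mul_ne_zero_iff.1 hab
    have hmem : b ∈ (p.bind k).support := (PMF.mem_support_bind_iff p k b).2
      ⟨a, (p.mem_support_iff a).2 ha, ((k a).mem_support_iff b).2 hb⟩
    rw [Function.uncurry_apply_pair, norm_smul, Real.norm_of_nonneg ENNReal.toReal_nonneg]
    exact mul_le_mul_of_nonneg_left (hC b hmem) ENNReal.toReal_nonneg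

lemma mean_bind {p : PMF α} {k : α → PMF β} {f : β → V} (h : BddOn (p.bind k) f) :
    mean (p.bind k) f = mean p fun a => mean (k a) f := by
  calc mean (p.bind k) f = ∑' b, ∑' a, (p a * k a b).toReal • f b :=
        tsum_congr fun b => toReal_bind_smul p k b (f b)
    _ = ∑' a, ∑' b, (p a * k a b).toReal • f b := (summable_uncurry_bind h).tsum_comm
    _ = mean p fun a => mean (k a) f := by
        simp only [mean, ENNReal.toReal_mul, mul_smul, tsum_const_smul'']

lemma mean_map {p : PMF α} {k : α → β} {f : β → V} (h : BddOn p fun a => f (k a)) :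
    mean (p.map k) f = mean p fun a => f (k a) := by
  have h' : BddOn (p.bind (PMF.pure ∘ k)) f := h.map
  rw [PMF.map, mean_bind h']
  simp only [Function.comp, mean_pure]

lemma integral_toMeasure [MeasurableSpace α] [DiscreteMeasurableSpace α]
    [SecondCountableTopology V] {p : PMF α} {f : α → V}
    (h : BddOn p f) : ∫ a, f a ∂p.toMeasure = mean p f :=
  PMF.integral_eq_tsum p f (integrable_toMeasure h)

end Mean

section MeanInner

variable {α V : Type*} [NormedAddCommGroup V] [InnerProductSpace ℝ V]

lemma BddOn.inner_left {p : PMF α} {f : α → V} (v : V) (hf : BddOn p f) :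
    BddOn p fun a => inner ℝ v (f a) := hf.clm (innerSL ℝ v)

variable [CompleteSpace V]

lemma mean_inner_left {p : PMF α} {f : α → V} (v : V) (hf : BddOn p f) :
    mean p (fun a => inner ℝ v (f a)) = inner ℝ v (mean p f) :=
  mean_clm (innerSL ℝ v) hf

lemma sq_norm_mean_le {p : PMF α} {f : α → V} (hf : BddOn p f) :
    ‖mean p f‖ ^ 2 ≤ mean p fun a => ‖f a‖ ^ 2 := by
  set m := mean p f with hm
  have hcross : BddOn p fun a => 2 * inner ℝ m (f a) := (hf.inner_left m).const_mul 2
  have h : mean p (fun a => 2 * inner ℝ m (f a) - ‖m‖ ^ 2) ≤ mean p fun a => ‖f a‖ ^ 2 := by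
    refine mean_mono (hcross.sub (BddOn.const p _)) hf.norm_sq fun a _ => ?_
    linarith [norm_sub_sq_real m (f a), sq_nonneg ‖m - f a‖]
  rw [mean_sub hcross (BddOn.const p _), mean_const, mean_mul 2 (hf.inner_left m),
    mean_inner_left m hf, ← hm, real_inner_self_eq_norm_sq] at h
  linarith

end MeanInner

/-! ### Finite Markov chains -/

section Primitive

variable {S : Type*} [Fintype S] [DecidableEq S] {P : Matrix S S ℝ}

lemma pow_add_apply_pos (hP : ∀ i j, 0 ≤ P i j) {a b : ℕ} {i j l : S}
    (ha : 0 < (P ^ a) i j) (hb : 0 < (P ^ b) j l) : 0 < (P ^ (a + b)) i l := by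
  rw [pow_add, Matrix.mul_apply]
  exact (mul_pos ha hb).trans_le (Finset.single_le_sum
    (f := fun x => (P ^ a) i x * (P ^ b) x l) (fun x _ => mul_nonneg
      (Matrix.pow_apply_nonneg hP a i x) (Matrix.pow_apply_nonneg hP b x l)) (Finset.mem_univ j))

lemma eventually_pow_apply_self_pos (hP : ∀ i j, 0 ≤ P i j) (s : S)
    (hA : ∀ p : ℕ, (∀ n : ℕ, 1 ≤ n → 0 < (P ^ n) s s → p ∣ n) → p = 1) :
    ∃ N, ∀ n ≥ N, 0 < (P ^ n) s s := by
  obtain ⟨N, hN⟩ := Nat.exists_mem_closure_of_ge {n : ℕ | 1 ≤ n ∧ 0 < (P ^ n) s s}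
  refine ⟨N, fun n hn => ?_⟩
  have hgcd : Nat.setGcd {n : ℕ | 1 ≤ n ∧ 0 < (P ^ n) s s} = 1 :=
    hA _ fun n hn hpos => Nat.setGcd_dvd_of_mem ⟨hn, hpos⟩
  refine AddSubmonoid.closure_induction (motive := fun n _ => 0 < (P ^ n) s s)
    (fun n hn => hn.2) (by simp) (fun a b _ _ ha hb => pow_add_apply_pos hP ha hb)
    (hN n hn (by rw [hgcd]; exact one_dvd n))

theorem isPrimitive_of_aperiodic (hI : P.IsIrreducible)
    (hA : ∀ (s : S) (p : ℕ), (∀ n : ℕ, 1 ≤ n → 0 < (P ^ n) s s → p ∣ n) → p = 1) :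
    P.IsPrimitive := by
  have hP := hI.nonneg
  choose k _ hk using (Matrix.isIrreducible_iff_exists_pow_pos hP).1 hI
  choose N hN using fun s => eventually_pow_apply_self_pos hP s (hA s)
  refine ⟨hP, (∑ i, N i) + (∑ i, ∑ j, k i j) + 1, by omega, fun i j => ?_⟩
  have hNi : N i ≤ ∑ i, N i := Finset.single_le_sum (fun _ _ => Nat.zero_le _) (Finset.mem_univ i)
  have hki : k i j ≤ ∑ i, ∑ j, k i j :=
    (Finset.single_le_sum (f := k i) (fun _ _ => Nat.zero_le _) (Finset.mem_univ j)).trans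
      (Finset.single_le_sum (f := fun i => ∑ j, k i j) (fun _ _ => Nat.zero_le _)
        (Finset.mem_univ i))
  have := pow_add_apply_pos hP (hN i ((∑ i, N i) + (∑ i, ∑ j, k i j) + 1 - k i j) (by omega))
    (hk i j)
  rwa [Nat.sub_add_cancel (by omega)] at this

end Primitive

section Stationary

variable {S : Type*} [Fintype S] {P : Matrix S S ℝ}

lemma abs_vecMul_le (hP : ∀ i j, 0 ≤ P i j) (x : S → ℝ) (s : S) :
    |(x ᵥ* P) s| ≤ (|x| ᵥ* P) s :=
  (Finset.abs_sum_le_sum_abs _ _).trans_eq <| Finset.sum_congr rfl fun i _ => by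
    rw [abs_mul, abs_of_nonneg (hP i s), Pi.abs_apply]

variable [DecidableEq S]

lemma sum_vecMul_of_mem_rowStochastic (hP : P ∈ Matrix.rowStochastic ℝ S) (x : S → ℝ) :
    ∑ s, (x ᵥ* P) s = ∑ s, x s := by
  have h := Matrix.dotProduct_mulVec x P 1
  rw [Matrix.one_vecMul_of_mem_rowStochastic hP, dotProduct_one, dotProduct_one] at h
  exact h.symm

lemma exists_ne_zero_vecMul_eq_self [Nonempty S] (hP : P ∈ Matrix.rowStochastic ℝ S) :
    ∃ x : S → ℝ, x ≠ 0 ∧ x ᵥ* P = x := by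
  have hdet : (P - 1).det = 0 := by
    rw [← Matrix.exists_mulVec_eq_zero_iff]
    refine ⟨1, one_ne_zero, ?_⟩
    rw [Matrix.sub_mulVec, Matrix.one_vecMul_of_mem_rowStochastic hP, Matrix.one_mulVec, sub_self]
  obtain ⟨x, hx0, hx⟩ := Matrix.exists_vecMul_eq_zero_iff.2 hdet
  exact ⟨x, hx0, by rwa [Matrix.vecMul_sub, Matrix.vecMul_one, sub_eq_zero] at hx⟩

theorem exists_mem_stdSimplex_vecMul_eq_self [Nonempty S]
    (hP : P ∈ Matrix.rowStochastic ℝ S) : ∃ q ∈ stdSimplex ℝ S, q ᵥ* P = q := by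
  obtain ⟨x, hx0, hx⟩ := exists_ne_zero_vecMul_eq_self hP
  have hle : ∀ s ∈ Finset.univ, |x| s ≤ (|x| ᵥ* P) s := fun s _ => by
    have h := abs_vecMul_le (P := P) (fun _ _ => Matrix.nonneg_of_mem_rowStochastic hP) x s
    rwa [hx] at h
  have hfix : |x| ᵥ* P = |x| := funext fun s =>
    ((Finset.sum_eq_sum_iff_of_le hle).1 (sum_vecMul_of_mem_rowStochastic hP |x|).symm s
      (Finset.mem_univ s)).symm
  have hpos : 0 < ∑ s, |x| s := by
    obtain ⟨s, hs⟩ := Function.ne_iff.1 hx0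
    exact (abs_pos.2 hs).trans_le
      (Finset.single_le_sum (f := |x|) (fun _ _ => abs_nonneg _) (Finset.mem_univ s))
  refine ⟨(∑ s, |x| s)⁻¹ • |x|, ⟨fun s => ?_, ?_⟩, by rw [Matrix.smul_vecMul, hfix]⟩
  · exact mul_nonneg (inv_nonneg.2 hpos.le) (abs_nonneg (x s))
  · simp only [Pi.smul_apply, smul_eq_mul]
    rw [← Finset.mul_sum, inv_mul_cancel₀ hpos.ne']

lemma vecMul_pow_eq_self {q : S → ℝ} (hq : q ᵥ* P = q) (n : ℕ) : q ᵥ* P ^ n = q := by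
  induction n with
  | zero => simp
  | succ n ih => rw [pow_succ, ← Matrix.vecMul_vecMul, ih, hq]

end Stationary

section Doeblin

variable {S : Type*} [Fintype S] [DecidableEq S] {P Q : Matrix S S ℝ}

lemma sum_abs_vecMul_le_of_minorized (hQ : Q ∈ Matrix.rowStochastic ℝ S) {ν : S → ℝ}
    (hν : ∀ i s, ν s ≤ Q i s) {x : S → ℝ} (hx : ∑ s, x s = 0) :
    ∑ s, |(x ᵥ* Q) s| ≤ (1 - ∑ s, ν s) * ∑ s, |x s| := by
  have hcentred : ∀ s, (x ᵥ* Q) s = ∑ i, x i * (Q i s - ν s) := fun s => by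
    simp_rw [mul_sub, Finset.sum_sub_distrib]
    rw [← Finset.sum_mul, hx, zero_mul, sub_zero]
    rfl
  calc ∑ s, |(x ᵥ* Q) s| ≤ ∑ s, ∑ i, |x i| * (Q i s - ν s) :=
        Finset.sum_le_sum fun s _ => by
          rw [hcentred]
          refine (Finset.abs_sum_le_sum_abs _ _).trans_eq (Finset.sum_congr rfl fun i _ => ?_)
          rw [abs_mul, abs_of_nonneg (sub_nonneg.2 (hν i s))]
    _ = (1 - ∑ s, ν s) * ∑ s, |x s| := by
        rw [Finset.sum_comm, Finset.mul_sum]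
        refine Finset.sum_congr rfl fun i _ => ?_
        rw [← Finset.mul_sum, Finset.sum_sub_distrib, Matrix.sum_row_of_mem_rowStochastic hQ,
          mul_comm]

lemma sum_abs_vecMul_pow_le_of_minorized [Nonempty S] (hQ : Q ∈ Matrix.rowStochastic ℝ S)
    {ν : S → ℝ} (hν : ∀ i s, ν s ≤ Q i s) {x : S → ℝ} (hx : ∑ s, x s = 0) (k : ℕ) :
    ∑ s, |(x ᵥ* Q ^ k) s| ≤ (1 - ∑ s, ν s) ^ k * ∑ s, |x s| := by
  have hν1 : ∑ s, ν s ≤ 1 := (Finset.sum_le_sum fun s _ => hν (Classical.arbitrary S) s).trans_eq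
    (Matrix.sum_row_of_mem_rowStochastic hQ _)
  induction k with
  | zero => simp
  | succ k ih =>
    have hzero : ∑ s, (x ᵥ* Q ^ k) s = 0 :=
      (sum_vecMul_of_mem_rowStochastic (pow_mem hQ k) x).trans hx
    rw [pow_succ Q, ← Matrix.vecMul_vecMul, pow_succ', mul_assoc]
    exact (sum_abs_vecMul_le_of_minorized hQ hν hzero).trans
      (mul_le_mul_of_nonneg_left ih (sub_nonneg.2 hν1))

lemma exists_sum_abs_vecMul_pow_le [Nonempty S] (hP : P ∈ Matrix.rowStochastic ℝ S)
    (hprim : P.IsPrimitive) {δ : ℝ} (hδ : 0 < δ) :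
    ∃ t, 1 ≤ t ∧ ∀ x : S → ℝ, ∑ s, x s = 0 → ∑ s, |(x ᵥ* P ^ t) s| ≤ δ * ∑ s, |x s| := by
  obtain ⟨n, hn, hpos⟩ := hprim.exists_pos_pow
  have hQ : P ^ n ∈ Matrix.rowStochastic ℝ S := pow_mem hP n
  obtain ⟨⟨i₀, j₀⟩, hmin⟩ := Finite.exists_min fun x : S × S => (P ^ n) x.1 x.2
  set ν : S → ℝ := fun _ => (P ^ n) i₀ j₀
  have hν : ∀ i s, ν s ≤ (P ^ n) i s := fun i s => hmin (i, s)
  have hν0 : 0 < ∑ s, ν s := Finset.sum_pos (fun _ _ => hpos i₀ j₀) Finset.univ_nonempty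
  have hν1 : ∑ s, ν s ≤ 1 := (Finset.sum_le_sum fun s _ => hν i₀ s).trans_eq
    (Matrix.sum_row_of_mem_rowStochastic hQ i₀)
  obtain ⟨k, hk⟩ := exists_pow_lt_of_lt_one hδ (show 1 - ∑ s, ν s < 1 by linarith)
  refine ⟨n * (k + 1), Nat.mul_pos hn k.succ_pos, fun x hx => ?_⟩
  rw [pow_mul]
  refine (sum_abs_vecMul_pow_le_of_minorized hQ hν hx (k + 1)).trans ?_
  refine mul_le_mul_of_nonneg_right ?_ (Finset.sum_nonneg fun _ _ => abs_nonneg _)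
  exact (pow_le_pow_of_le_one (by linarith) (by linarith) k.le_succ).trans hk.le

theorem exists_sum_abs_pow_sub_le [Nonempty S] (hP : P ∈ Matrix.rowStochastic ℝ S)
    (hprim : P.IsPrimitive) {q : S → ℝ} (hq : q ∈ stdSimplex ℝ S) (hqP : q ᵥ* P = q) {δ : ℝ}
    (hδ : 0 < δ) : ∃ t, 1 ≤ t ∧ ∀ s, ∑ s', |(P ^ t) s s' - q s'| ≤ δ := by
  obtain ⟨t, ht1, ht⟩ := exists_sum_abs_vecMul_pow_le hP hprim (half_pos hδ)
  refine ⟨t, ht1, fun s => ?_⟩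
  set x : S → ℝ := Pi.single s 1 - q with hx
  have hzero : ∑ s', x s' = 0 := by simp [hx, Finset.sum_sub_distrib, hq.2]
  have hsingle : 0 ≤ (Pi.single s 1 : S → ℝ) := Pi.single_nonneg.2 zero_le_one
  have hnorm : ∑ s', |x s'| ≤ 2 := by
    calc ∑ s', |x s'| ≤ ∑ s', ((Pi.single s 1 : S → ℝ) s' + q s') :=
          Finset.sum_le_sum fun s' _ => (abs_sub _ _).trans_eq <| by
            rw [abs_of_nonneg (hq.1 s'), abs_of_nonneg (hsingle s')]
      _ = 2 := by simp [Finset.sum_add_distrib, hq.2, one_add_one_eq_two]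
  have hrow : ∀ s', (P ^ t) s s' - q s' = (x ᵥ* P ^ t) s' := fun s' => by
    rw [hx, Matrix.sub_vecMul, Matrix.single_one_vecMul, vecMul_pow_eq_self hqP]
    rfl
  simp_rw [hrow]
  exact (ht x hzero).trans (by nlinarith)

end Doeblin

section Decay

variable {S : Type*} [Fintype S] {P : Matrix S S ℝ}

variable {V : Type*} [NormedAddCommGroup V] [NormedSpace ℝ V]

/-- The action `(P F)(s) = ∑ s', P(s, s') F(s')` of a kernel on vector-valued functions. -/
def act (P : Matrix S S ℝ) (F : S → V) (s : S) : V := ∑ s', P s s' • F s'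

lemma sum_smul_act {q : S → ℝ} (hq : q ᵥ* P = q) (F : S → V) :
    ∑ s, q s • act P F s = ∑ s, q s • F s := by
  simp only [act, Finset.smul_sum]
  rw [Finset.sum_comm]
  refine Finset.sum_congr rfl fun s' _ => ?_
  simp_rw [smul_smul]
  rw [← Finset.sum_smul]
  congr 1
  exact congrFun hq s'

lemma act_mul (P Q : Matrix S S ℝ) (F : S → V) : act (P * Q) F = act P (act Q F) := by
  ext s
  simp only [act, Matrix.mul_apply, Finset.smul_sum, Finset.sum_smul, mul_smul]
  exact Finset.sum_comm

variable [DecidableEq S]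

lemma act_one (F : S → V) : act 1 F = F := by
  ext s
  simp [act, Matrix.one_apply, ite_smul]

lemma norm_act_le (hP : P ∈ Matrix.rowStochastic ℝ S) {F : S → V} {G : ℝ}
    (hF : ∀ s, ‖F s‖ ≤ G) (s : S) : ‖act P F s‖ ≤ G := by
  calc ‖act P F s‖ ≤ ∑ s', P s s' * G := norm_sum_le_of_le _ fun s' _ => by
        rw [norm_smul, Real.norm_of_nonneg (Matrix.nonneg_of_mem_rowStochastic hP)]
        exact mul_le_mul_of_nonneg_left (hF s') (Matrix.nonneg_of_mem_rowStochastic hP)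
    _ = G := by rw [← Finset.sum_mul, Matrix.sum_row_of_mem_rowStochastic hP, one_mul]

lemma norm_act_pow_le_half {q : S → ℝ} {t : ℕ}
    (ht : ∀ s, (1 / 2 : ℝ) * ∑ s', |(P ^ t) s s' - q s'| ≤ 1 / 4) {F : S → V} {G : ℝ}
    (hF0 : ∑ s, q s • F s = 0) (hF : ∀ s, ‖F s‖ ≤ G) (s : S) :
    ‖act (P ^ t) F s‖ ≤ G / 2 := by
  have hG : 0 ≤ G := (norm_nonneg _).trans (hF s)
  have hcentred : act (P ^ t) F s = ∑ s', ((P ^ t) s s' - q s') • F s' := by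
    simp_rw [sub_smul]
    rw [Finset.sum_sub_distrib, hF0, sub_zero]
    rfl
  rw [hcentred]
  calc ‖∑ s', ((P ^ t) s s' - q s') • F s'‖ ≤ ∑ s', |(P ^ t) s s' - q s'| * G :=
        norm_sum_le_of_le _ fun s' _ => by
          rw [norm_smul, Real.norm_eq_abs]
          exact mul_le_mul_of_nonneg_left (hF s') (abs_nonneg _)
    _ = (∑ s', |(P ^ t) s s' - q s'|) * G := by rw [Finset.sum_mul]
    _ ≤ 1 / 2 * G := mul_le_mul_of_nonneg_right (by linarith [ht s]) hG
    _ = G / 2 := by ring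

/-- Every `t` steps halve the sup norm of a centred function, so the sums over successive blocks of
length `t` are dominated by a geometric series. -/
theorem sum_norm_act_pow_le (hP : P ∈ Matrix.rowStochastic ℝ S) {q : S → ℝ} (hq : q ᵥ* P = q)
    {t : ℕ} (ht1 : 1 ≤ t) (ht : ∀ s, (1 / 2 : ℝ) * ∑ s', |(P ^ t) s s' - q s'| ≤ 1 / 4) (n : ℕ) :
    ∀ {F : S → V} {G : ℝ}, ∑ s, q s • F s = 0 → (∀ s, ‖F s‖ ≤ G) → ∀ s,
      ∑ i ∈ Finset.range n, ‖act (P ^ i) F s‖ ≤ 2 * t * G := by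
  induction n using Nat.strong_induction_on with
  | _ n ih =>
    intro F G hF0 hF s
    have hG : 0 ≤ G := (norm_nonneg _).trans (hF s)
    have hfirst : ∀ k ≤ t, ∑ i ∈ Finset.range k, ‖act (P ^ i) F s‖ ≤ t * G := by
      intro k hk
      calc ∑ i ∈ Finset.range k, ‖act (P ^ i) F s‖ ≤ ∑ _i ∈ Finset.range k, G :=
            Finset.sum_le_sum fun i _ => norm_act_le (pow_mem hP i) hF s
        _ = k * G := by simp
        _ ≤ t * G := by gcongr
    rcases le_or_gt n t with hn | hn
    · refine (hfirst n hn).trans ?_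
      have : 0 ≤ t * G := by positivity
      linarith
    · obtain ⟨k, rfl⟩ := Nat.exists_eq_add_of_lt hn
      rw [show t + k + 1 = t + (k + 1) by ring, Finset.sum_range_add]
      have htail := ih (k + 1) (by omega) (F := act (P ^ t) F) (G := G / 2)
        ((sum_smul_act (vecMul_pow_eq_self hq t) F).trans hF0) (norm_act_pow_le_half ht hF0 hF) s
      have hshift : ∀ i, act (P ^ (t + i)) F s = act (P ^ i) (act (P ^ t) F) s := fun i => by
        rw [← act_mul, ← pow_add, add_comm]
      simp_rw [hshift]
      linarith [hfirst t le_rfl]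

end Decay

/-! ### Moments of trajectory sums -/

namespace CMDP

variable {S A : Type*} (M : CMDP S A) (π : S → PMF A)

lemma nonempty_state {S A : Type*} (M : CMDP S A) : Nonempty S := ⟨M.ρ.support_nonempty.some⟩

lemma length_of_mem_support_trajLaw (n : ℕ) (s : S) {zs : List (Transition S A)}
    (h : zs ∈ (M.trajLaw π n s).support) : zs.length = n := by
  induction n generalizing s zs with
  | zero =>
    rw [trajLaw, PMF.mem_support_pure_iff] at h
    simp [h]
  | succ n ih =>
    rw [trajLaw, PMF.mem_support_bind_iff] at h
    obtain ⟨a, -, h⟩ := h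
    rw [PMF.mem_support_bind_iff] at h
    obtain ⟨s', -, h⟩ := h
    rw [PMF.mem_support_map_iff] at h
    obtain ⟨zs', h', rfl⟩ := h
    simp [ih s' h']

lemma trajLaw_map_take {k n : ℕ} (hk : k ≤ n) (s : S) :
    (M.trajLaw π n s).map (List.take k) = M.trajLaw π k s := by
  induction k generalizing n s with
  | zero =>
    have : (List.take 0 : List (Transition S A) → _) = Function.const _ [] := by ext; simp
    rw [this, PMF.map_const, trajLaw]
  | succ k ih =>
    obtain ⟨n, rfl⟩ : ∃ n', n = n' + 1 := ⟨n - 1, by omega⟩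
    simp only [trajLaw, PMF.map_bind]
    refine congrArg _ (funext fun a => congrArg _ (funext fun s' => ?_))
    rw [PMF.map_comp, ← ih (n := n) (by omega) s', PMF.map_comp]
    rfl

section Finite

variable [Finite S] [Finite A] {V : Type*} [NormedAddCommGroup V]

lemma bddOn_trajLaw (n : ℕ) (s : S) (F : List (Transition S A) → V) :
    BddOn (M.trajLaw π n s) F := by
  have hfin : {l : List (Transition S A) | l.length = n}.Finite := List.finite_length_eq _ n
  obtain ⟨C, hC⟩ := (hfin.image fun l => ‖F l‖).bddAbove
  exact ⟨C, fun l hl => hC ⟨l, M.length_of_mem_support_trajLaw π n s hl, rfl⟩⟩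

lemma mean_trajLaw_norm_add_sum_sq [InnerProductSpace ℝ V] [CompleteSpace V] (n : ℕ) (s : S)
    (f : Transition S A → V) (v : V) :
    mean (M.trajLaw π n s) (fun zs => ‖v + (zs.map f).sum‖ ^ 2) =
      ‖v‖ ^ 2 + 2 * inner ℝ v (mean (M.trajLaw π n s) fun zs => (zs.map f).sum) +
        mean (M.trajLaw π n s) fun zs => ‖(zs.map f).sum‖ ^ 2 := by
  simp_rw [norm_add_sq_real]
  rw [mean_add (M.bddOn_trajLaw π n s _) (M.bddOn_trajLaw π n s _),
    mean_add (BddOn.const _ _) (M.bddOn_trajLaw π n s _), mean_const,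
    mean_mul _ (M.bddOn_trajLaw π n s _), mean_inner_left _ (M.bddOn_trajLaw π n s _)]

end Finite

section Moments

/-- The one-step transition weight `π(a | s) P(s' | s, a)`. -/
def weight (s : S) (a : A) (s' : S) : ℝ := (π s a).toReal * (M.P s a s').toReal

lemma weight_nonneg (s : S) (a : A) (s' : S) : 0 ≤ M.weight π s a s' :=
  mul_nonneg ENNReal.toReal_nonneg ENNReal.toReal_nonneg

variable [Fintype A]

lemma transitionMatrix_apply (s s' : S) :
    M.transitionMatrix π s s' = ∑ a, M.weight π s a s' := rfl

variable [Fintype S]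

lemma sum_toReal {α : Type*} [Fintype α] (p : PMF α) : ∑ a, (p a).toReal = 1 :=
  (tsum_fintype _).symm.trans (hasSum_toReal p).tsum_eq

lemma sum_weight (s : S) : ∑ a, ∑ s', M.weight π s a s' = 1 := by
  simp only [weight, ← Finset.mul_sum, sum_toReal, mul_one]

lemma transitionMatrix_mem_rowStochastic [DecidableEq S] :
    M.transitionMatrix π ∈ Matrix.rowStochastic ℝ S := by
  rw [Matrix.mem_rowStochastic_iff_sum]
  refine ⟨fun s s' => ?_, fun s => ?_⟩
  · rw [transitionMatrix_apply]
    exact Finset.sum_nonneg fun a _ => M.weight_nonneg π s a s'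
  · simp_rw [transitionMatrix_apply]
    rw [Finset.sum_comm, M.sum_weight]

lemma isStationary_stationary : M.IsStationary π (M.stationary π) := by
  classical
  have := M.nonempty_state
  obtain ⟨q, hq, hqP⟩ :=
    exists_mem_stdSimplex_vecMul_eq_self (M.transitionMatrix_mem_rowStochastic π)
  exact Classical.epsilon_spec ⟨q, hq.1, hq.2, hqP⟩

variable {V : Type*} [NormedAddCommGroup V] [NormedSpace ℝ V]

lemma act_transitionMatrix (F : S → V) (s : S) :
    act (M.transitionMatrix π) F s = ∑ a, ∑ s', M.weight π s a s' • F s' := by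
  rw [act, Finset.sum_comm]
  simp_rw [transitionMatrix_apply, Finset.sum_smul]

/-- The mean of `f(s, a, s')` for `a ∼ π(s)` and `s' ∼ P(s, a)`. -/
def stepMean (f : Transition S A → V) (s : S) : V :=
  ∑ a, ∑ s', M.weight π s a s' • f (s, a, s')

lemma stationaryMean_eq (f : Transition S A → V) :
    M.stationaryMean π f = ∑ s, M.stationary π s • M.stepMean π f s := by
  simp only [stationaryMean, stepMean, weight, Finset.smul_sum, smul_smul, mul_assoc]

lemma norm_stepMean_le {f : Transition S A → V} {C : ℝ} (h : ∀ z, ‖f z‖ ≤ C) (s : S) :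
    ‖M.stepMean π f s‖ ≤ C := by
  calc ‖M.stepMean π f s‖ ≤ ∑ a, ∑ s', M.weight π s a s' * C :=
        norm_sum_le_of_le _ fun a _ => norm_sum_le_of_le _ fun s' _ => by
          rw [norm_smul, Real.norm_of_nonneg (M.weight_nonneg π s a s')]
          exact mul_le_mul_of_nonneg_left (h _) (M.weight_nonneg π s a s')
    _ = C := by simp_rw [← Finset.sum_mul]; rw [M.sum_weight, one_mul]

variable [CompleteSpace V]

lemma mean_trajLaw_succ (n : ℕ) (s : S) (F : List (Transition S A) → V) :
    mean (M.trajLaw π (n + 1) s) F =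
      ∑ a, ∑ s', M.weight π s a s' • mean (M.trajLaw π n s') fun zs => F ((s, a, s') :: zs) := by
  have hb := M.bddOn_trajLaw π (n + 1) s F
  rw [trajLaw] at hb ⊢
  rw [mean_bind hb, mean_fintype]
  refine Finset.sum_congr rfl fun a _ => ?_
  by_cases ha : π s a = 0
  · simp [ha, weight]
  have hb' := hb.of_bind ((PMF.mem_support_iff _ _).2 ha)
  rw [mean_bind hb', mean_fintype, Finset.smul_sum]
  refine Finset.sum_congr rfl fun s' _ => ?_
  rw [mean_map (M.bddOn_trajLaw π n s' _), weight, mul_smul]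

lemma mean_trajLaw_sum [DecidableEq S] (n : ℕ) (s : S) (f : Transition S A → V) :
    mean (M.trajLaw π n s) (fun zs => (zs.map f).sum) =
      ∑ t ∈ Finset.range n, act (M.transitionMatrix π ^ t) (M.stepMean π f) s := by
  induction n generalizing s with
  | zero => simp [trajLaw, mean_pure]
  | succ n ih =>
    rw [mean_trajLaw_succ, Finset.sum_range_succ']
    have hcons : ∀ a s', mean (M.trajLaw π n s')
        (fun zs => (((s, a, s') :: zs : List (Transition S A)).map f).sum) = f (s, a, s') +
          ∑ t ∈ Finset.range n, act (M.transitionMatrix π ^ t) (M.stepMean π f) s' := by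
      intro a s'
      simp only [List.map_cons, List.sum_cons]
      rw [mean_add (BddOn.const _ _) (M.bddOn_trajLaw π n s' _), mean_const, ih]
    simp_rw [hcons, smul_add, Finset.sum_add_distrib]
    rw [pow_zero, act_one, add_comm]
    congr 1
    simp_rw [pow_succ', act_mul, act_transitionMatrix, Finset.smul_sum]
    rw [Finset.sum_comm]
    conv_rhs => rw [Finset.sum_comm]
    rw [Finset.sum_comm]
    refine Finset.sum_congr rfl fun a _ => ?_
    rw [Finset.sum_comm]

end Moments

section Mixing

variable [Fintype S] [Fintype A] [DecidableEq S]

/-- The chain induced by `π` has a mixing time of at most `τ`. -/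
def MixedBy (τ : ℕ) : Prop :=
  ∃ t, 1 ≤ t ∧ t ≤ τ ∧
    ∀ s, (1 / 2 : ℝ) * ∑ s', |(M.transitionMatrix π ^ t) s s' - M.stationary π s'| ≤ 1 / 4

lemma mixedBy_mixingTime (hM : M.Ergodic) : M.MixedBy π (M.mixingTime π) := by
  have := M.nonempty_state
  obtain ⟨hnonneg, hsum, hinv⟩ := M.isStationary_stationary π
  obtain ⟨t, ht1, ht⟩ := exists_sum_abs_pow_sub_le (M.transitionMatrix_mem_rowStochastic π)
    (isPrimitive_of_aperiodic (hM π).1 (hM π).2) ⟨hnonneg, hsum⟩ hinv (δ := 1 / 2) (by norm_num)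
  have hmem := Nat.sInf_mem (s := {t : ℕ | 1 ≤ t ∧
    ∀ s, (1 / 2 : ℝ) * ∑ s', |(M.transitionMatrix π ^ t) s s' - M.stationary π s'| ≤ 1 / 4})
    ⟨t, ht1, fun s => by linarith [ht s]⟩
  exact ⟨_, hmem.1, le_rfl, hmem.2⟩

lemma mixedBy_tauMix (hM : M.Ergodic) {d : ℕ} (π : ParamSpace d → S → PMF A)
    {Θ : Set (ParamSpace d)} (hτ : M.tauMix π Θ ≠ 0) {θ : ParamSpace d} (hθ : θ ∈ Θ) :
    M.MixedBy (π θ) (M.tauMix π Θ) := by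
  obtain ⟨t, ht1, htle, ht⟩ := M.mixedBy_mixingTime (π θ) hM
  refine ⟨t, ht1, htle.trans ?_, ht⟩
  have hb : BddAbove (Set.range fun θ : Θ => M.mixingTime (π θ)) := by
    by_contra h
    exact hτ (Nat.sSup_of_not_bddAbove h)
  exact le_ciSup hb ⟨θ, hθ⟩

variable {V : Type*} [NormedAddCommGroup V] {M π} {τ : ℕ}

lemma MixedBy.one_le (hτ : M.MixedBy π τ) : 1 ≤ τ := by
  obtain ⟨t, ht1, htle, -⟩ := hτ
  exact ht1.trans htle

lemma norm_mean_trajLaw_sum_le [NormedSpace ℝ V] [CompleteSpace V] (hτ : M.MixedBy π τ)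
    {f : Transition S A → V} {G : ℝ} (hf : M.stationaryMean π f = 0) (hG : ∀ z, ‖f z‖ ≤ G)
    (n : ℕ) (s : S) : ‖mean (M.trajLaw π n s) (fun zs => (zs.map f).sum)‖ ≤ 2 * τ * G := by
  obtain ⟨t, ht1, htle, ht⟩ := hτ
  rw [mean_trajLaw_sum]
  rw [stationaryMean_eq] at hf
  have hG' := M.norm_stepMean_le π hG
  have hG0 : 0 ≤ G := (norm_nonneg _).trans (hG' s)
  refine (norm_sum_le _ _).trans ((sum_norm_act_pow_le (M.transitionMatrix_mem_rowStochastic π)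
    (M.isStationary_stationary π).2.2 ht1 ht n hf hG' s).trans ?_)
  gcongr

lemma mean_trajLaw_norm_sum_sq_le [InnerProductSpace ℝ V] [CompleteSpace V] (hτ : M.MixedBy π τ)
    {f : Transition S A → V} {G : ℝ} (hf : M.stationaryMean π f = 0) (hG : ∀ z, ‖f z‖ ≤ G)
    (n : ℕ) (s : S) :
    mean (M.trajLaw π n s) (fun zs => ‖(zs.map f).sum‖ ^ 2) ≤ 5 * n * τ * G ^ 2 := by
  have hτ1 : (1 : ℝ) ≤ τ := by exact_mod_cast hτ.one_le
  induction n generalizing s with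
  | zero => simp [trajLaw, mean_pure]
  | succ n ih =>
    have hcons : ∀ a s', mean (M.trajLaw π n s')
        (fun zs => ‖(((s, a, s') :: zs : List (Transition S A)).map f).sum‖ ^ 2) ≤
          5 * (n + 1) * τ * G ^ 2 := by
      intro a s'
      simp only [List.map_cons, List.sum_cons]
      rw [mean_trajLaw_norm_add_sum_sq]
      set v := f (s, a, s')
      have hv : ‖v‖ ≤ G := hG _
      have hcross := (real_inner_le_norm v (mean (M.trajLaw π n s') fun zs => (zs.map f).sum)).trans
        (mul_le_mul hv (norm_mean_trajLaw_sum_le hτ hf hG n s') (norm_nonneg _)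
          ((norm_nonneg v).trans hv))
      have hv2 : ‖v‖ ^ 2 ≤ G ^ 2 := pow_le_pow_left₀ (norm_nonneg v) hv 2
      nlinarith [ih s', mul_le_mul_of_nonneg_right hτ1 (sq_nonneg G)]
    rw [mean_trajLaw_succ]
    calc _ ≤ ∑ a, ∑ s', M.weight π s a s' * (5 * (n + 1) * τ * G ^ 2) :=
          Finset.sum_le_sum fun a _ => Finset.sum_le_sum fun s' _ =>
            mul_le_mul_of_nonneg_left (hcons a s') (M.weight_nonneg π s a s')
      _ = 5 * (n + 1 : ℕ) * τ * G ^ 2 := by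
          simp_rw [← Finset.sum_mul]
          rw [M.sum_weight]
          push_cast
          ring

end Mixing

end CMDP

/-! ### Moments of the multi-level Monte Carlo estimate -/

section Level

lemma levelLaw_zero : levelLaw 0 = 0 := by
  rw [levelLaw, PMF.apply_eq_zero_iff, PMF.mem_support_map_iff]
  rintro ⟨n, -, hn⟩
  omega

lemma levelLaw_succ_toReal (n : ℕ) : (levelLaw (n + 1)).toReal = (1 / 2) ^ (n + 1) := by
  have hp : (⟨1 / 2, by norm_num, by norm_num⟩ : unitInterval) ≠ 0 := by
    intro h
    have := congrArg Subtype.val h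
    norm_num at this
  rw [levelLaw, PMF.map_apply, tsum_eq_single n]
  · rw [if_pos rfl, Measure.toPMF_apply, geometricMeasure_singleton hp,
      ENNReal.toReal_ofReal (geometricMeasure_nonneg _ n)]
    norm_num [pow_succ]
  · intro b hb
    rw [if_neg]
    omega

lemma one_le_of_mem_support_levelLaw {q : ℕ} (hq : q ∈ levelLaw.support) : 1 ≤ q := by
  rcases Nat.eq_zero_or_pos q with rfl | h
  · exact absurd levelLaw_zero ((PMF.mem_support_iff _ _).1 hq)
  · exact h

lemma one_le_trajLength (Tmax q : ℕ) : 1 ≤ trajLength Tmax q := by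
  rw [trajLength]
  split_ifs
  · exact Nat.one_le_two_pow
  · exact le_rfl

variable {V : Type*} [NormedAddCommGroup V]

lemma mean_levelLaw_ite [NormedSpace ℝ V] {Tmax : ℕ} (hT : Tmax ≠ 0) (D : ℕ → V) :
    mean levelLaw (fun q => if 2 ^ q ≤ Tmax then (2 : ℝ) ^ q • D q else 0) =
      ∑ j ∈ Finset.range (Nat.log 2 Tmax), D (j + 1) := by
  have hiff : ∀ q, 2 ^ q ≤ Tmax ↔ q ≤ Nat.log 2 Tmax := fun q =>
    (Nat.le_log_iff_pow_le (by norm_num) hT).symm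
  rw [mean, tsum_eq_sum (s := Finset.range (Nat.log 2 Tmax + 1))]
  · rw [Finset.sum_range_succ', levelLaw_zero, ENNReal.toReal_zero, zero_smul, add_zero]
    refine Finset.sum_congr rfl fun j hj => ?_
    rw [if_pos ((hiff _).2 (Finset.mem_range.1 hj)), levelLaw_succ_toReal, smul_smul, ← mul_pow]
    norm_num
  · intro q hq
    rw [if_neg, smul_zero]
    rw [hiff]
    simpa [Nat.lt_succ_iff] using hq

lemma bddOn_levelLaw_ite (Tmax : ℕ) (D : ℕ → V) :
    BddOn levelLaw (fun q => if 2 ^ q ≤ Tmax then D q else 0) := by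
  refine ⟨∑ j ∈ Finset.range Tmax, ‖D j‖, fun q _ => ?_⟩
  beta_reduce
  split_ifs with h
  · exact Finset.single_le_sum (f := fun j => ‖D j‖) (fun _ _ => norm_nonneg _)
      (Finset.mem_range.2 (q.lt_two_pow_self.trans_le h))
  · rw [norm_zero]
    exact Finset.sum_nonneg fun _ _ => norm_nonneg _

end Level

section LevelMean

variable {Z V : Type*} [NormedAddCommGroup V]

lemma norm_sum_map_le {f : Z → V} {G : ℝ} (hG : ∀ z, ‖f z‖ ≤ G) (zs : List Z) :
    ‖(zs.map f).sum‖ ≤ zs.length * G := by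
  induction zs with
  | nil => simp
  | cons z zs ih =>
    rw [List.map_cons, List.sum_cons, List.length_cons]
    push_cast
    linarith [norm_add_le (f z) (zs.map f).sum, hG z]

variable [NormedSpace ℝ V]

lemma norm_levelMean_le {f : Z → V} {G : ℝ} (hG0 : 0 ≤ G) (hG : ∀ z, ‖f z‖ ≤ G) (zs : List Z)
    (j : ℕ) : ‖levelMean f zs j‖ ≤ G := by
  have hlen : ((zs.take (2 ^ j)).length : ℝ) ≤ 2 ^ j := by
    exact_mod_cast List.length_take_le _ _
  rw [levelMean, norm_smul, norm_inv, norm_pow, Real.norm_ofNat, inv_mul_le_iff₀ (by positivity)]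
  exact (norm_sum_map_le hG _).trans (mul_le_mul_of_nonneg_right hlen hG0)

lemma norm_mlmc_le {f : Z → V} {G : ℝ} (hG0 : 0 ≤ G) (hG : ∀ z, ‖f z‖ ≤ G) (Tmax q : ℕ)
    (zs : List Z) : ‖mlmc Tmax f q zs‖ ≤ (1 + 2 * Tmax) * G := by
  have h := norm_levelMean_le hG0 hG zs
  have hcorrection : ‖if 2 ^ q ≤ Tmax then
      (2 : ℝ) ^ q • (levelMean f zs q - levelMean f zs (q - 1)) else 0‖ ≤ Tmax * (2 * G) := by
    split_ifs with hq
    · rw [norm_smul, norm_pow, Real.norm_ofNat]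
      have hq' : (2 : ℝ) ^ q ≤ Tmax := by exact_mod_cast hq
      have := norm_sub_le (levelMean f zs q) (levelMean f zs (q - 1))
      exact mul_le_mul hq' (by linarith [h q, h (q - 1)]) (norm_nonneg _) (by positivity)
    · rw [norm_zero]
      positivity
  rw [mlmc]
  linarith [norm_add_le_of_le (h 0) hcorrection]

lemma levelMean_take (f : Z → V) (zs : List Z) (j : ℕ) :
    levelMean f (zs.take (2 ^ j)) j = levelMean f zs j := by
  simp [levelMean, List.take_take]

lemma levelMean_of_length_eq (f : Z → V) {zs : List Z} {j : ℕ} (h : zs.length = 2 ^ j) :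
    levelMean f zs j = ((2 : ℝ) ^ j)⁻¹ • (zs.map f).sum := by
  rw [levelMean, List.take_of_length_le h.le]

lemma sum_map_sub_const (f : Z → V) (c : V) (zs : List Z) :
    (zs.map fun z => f z - c).sum = (zs.map f).sum - (zs.length : ℝ) • c := by
  induction zs with
  | nil => simp
  | cons z zs ih =>
    simp only [List.map_cons, List.sum_cons, ih, List.length_cons, Nat.cast_add, Nat.cast_one,
      add_smul, one_smul]
    abel

lemma levelMean_sub_const (f : Z → V) (c : V) {zs : List Z} {j : ℕ} (h : 2 ^ j ≤ zs.length) :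
    levelMean (fun z => f z - c) zs j = levelMean f zs j - c := by
  rw [levelMean, sum_map_sub_const, List.length_take, min_eq_left h, smul_sub, smul_smul]
  push_cast
  rw [inv_mul_cancel₀ (by positivity), one_smul]
  rfl

lemma norm_mlmc_sq_le {f : Z → V} {B : ℝ} (hB0 : 0 ≤ B) (hB : ∀ z, ‖f z‖ ≤ B) (c : V)
    (Tmax : ℕ) {q : ℕ} {zs : List Z} (hq : 2 ^ q ≤ zs.length) :
    ‖mlmc Tmax f q zs‖ ^ 2 ≤ 2 * B ^ 2 + if 2 ^ q ≤ Tmax then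
      4 * (2 ^ q) ^ 2 * (‖levelMean (fun z => f z - c) zs q‖ ^ 2 +
        ‖levelMean (fun z => f z - c) zs (q - 1)‖ ^ 2) else 0 := by
  have hzero := norm_levelMean_le hB0 hB zs 0
  rw [mlmc]
  split_ifs
  · rw [levelMean_sub_const f c hq, levelMean_sub_const f c
      ((Nat.pow_le_pow_right (by norm_num) (Nat.sub_le q 1)).trans hq)]
    set u := levelMean f zs q
    set v := levelMean f zs (q - 1)
    have huv : ‖(2 : ℝ) ^ q • (u - v)‖ ≤ 2 ^ q * (‖u - c‖ + ‖v - c‖) := by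
      rw [norm_smul, norm_pow, Real.norm_ofNat, ← sub_sub_sub_cancel_right u v c]
      gcongr
      exact norm_sub_le _ _
    calc _ ≤ (B + 2 ^ q * (‖u - c‖ + ‖v - c‖)) ^ 2 := by
          gcongr
          exact norm_add_le_of_le hzero huv
      _ ≤ 2 * (B ^ 2 + (2 ^ q * (‖u - c‖ + ‖v - c‖)) ^ 2) := add_sq_le
      _ = 2 * B ^ 2 + 2 * (2 ^ q) ^ 2 * (‖u - c‖ + ‖v - c‖) ^ 2 := by ring
      _ ≤ 2 * B ^ 2 + 2 * (2 ^ q) ^ 2 * (2 * (‖u - c‖ ^ 2 + ‖v - c‖ ^ 2)) := by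
          gcongr
          exact add_sq_le
      _ = _ := by ring
  · rw [add_zero, add_zero]
    nlinarith [pow_le_pow_left₀ (norm_nonneg _) hzero 2]

end LevelMean

namespace CMDP

variable {S A : Type*} (M : CMDP S A) (π : S → PMF A) (Tmax : ℕ)

/-- The law of one inner-loop step from the state `s`. -/
def stepLaw (s : S) : PMF (InnerSample S A) :=
  levelLaw.bind fun q => (M.trajLaw π (trajLength Tmax q) s).map fun zs => (q, zs)

variable {V : Type*} [NormedAddCommGroup V] [NormedSpace ℝ V]

lemma bddOn_stepLaw_mlmc [Finite S] [Finite A] (f : Transition S A → V) (s : S) :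
    BddOn (M.stepLaw π Tmax s) (fun x => mlmc Tmax f x.1 x.2) := by
  obtain ⟨G, hG⟩ := (Set.finite_range fun z => ‖f z‖).bddAbove
  exact BddOn.of_forall ((1 + 2 * Tmax) * max G 0) fun x =>
    norm_mlmc_le (le_max_right _ _) (fun z => (hG ⟨z, rfl⟩).trans (le_max_left _ _)) Tmax x.1 x.2

variable {M π Tmax}

lemma mean_trajLaw_levelMean [Finite S] [Finite A] {W : Type*} [NormedAddCommGroup W]
    [NormedSpace ℝ W] [CompleteSpace W] (f : Transition S A → V) (Φ : V → W) {n j : ℕ}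
    (h : 2 ^ j ≤ n) (s : S) :
    mean (M.trajLaw π n s) (fun zs => Φ (levelMean f zs j)) =
      mean (M.trajLaw π (2 ^ j) s) (fun zs => Φ (levelMean f zs j)) := by
  rw [← M.trajLaw_map_take π h, mean_map (M.bddOn_trajLaw π n s _)]
  simp_rw [levelMean_take]

variable [CompleteSpace V]

lemma mean_stepLaw [Finite S] [Finite A] {s : S} {F : InnerSample S A → V}
    (hF : BddOn (M.stepLaw π Tmax s) F) :
    mean (M.stepLaw π Tmax s) F =
      mean levelLaw fun q => mean (M.trajLaw π (trajLength Tmax q) s) fun zs => F (q, zs) := by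
  rw [stepLaw] at hF ⊢
  rw [mean_bind hF]
  exact mean_congr fun q _ => mean_map (M.bddOn_trajLaw π _ s _)

lemma bddOn_mean_trajLaw [Finite S] [Finite A] {s : S} {F : InnerSample S A → V}
    (hF : BddOn (M.stepLaw π Tmax s) F) : BddOn levelLaw fun q =>
      mean (M.trajLaw π (trajLength Tmax q) s) fun zs => F (q, zs) := by
  obtain ⟨C, hC⟩ := BddOn.mean_bind (p := levelLaw) hF
  refine ⟨C, fun q hq => ?_⟩
  have := hC q hq
  beta_reduce at this ⊢
  rwa [mean_map (M.bddOn_trajLaw π _ s _)] at this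

section FirstMoment

variable [Finite S] [Finite A]

lemma mean_trajLaw_mlmc (f : Transition S A → V) (q : ℕ) (s : S) :
    mean (M.trajLaw π (trajLength Tmax q) s) (mlmc Tmax f q) =
      mean (M.trajLaw π (2 ^ 0) s) (levelMean f · 0) + if 2 ^ q ≤ Tmax then (2 : ℝ) ^ q •
        (mean (M.trajLaw π (2 ^ q) s) (levelMean f · q) -
          mean (M.trajLaw π (2 ^ (q - 1)) s) (levelMean f · (q - 1))) else 0 := by
  unfold mlmc
  rw [mean_add (M.bddOn_trajLaw π _ s _) (M.bddOn_trajLaw π _ s _),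
    mean_trajLaw_levelMean f (fun v => v) (j := 0)
      (by simpa using one_le_trajLength Tmax q)]
  congr 1
  by_cases hq : 2 ^ q ≤ Tmax
  · simp only [hq, if_true]
    rw [mean_smul _ (M.bddOn_trajLaw π _ s _),
      mean_sub (M.bddOn_trajLaw π _ s _) (M.bddOn_trajLaw π _ s _), trajLength, if_pos hq,
      mean_trajLaw_levelMean f (fun v => v) (j := q - 1)
        (Nat.pow_le_pow_right (by norm_num) (Nat.sub_le q 1))]
  · simp only [hq, if_false]
    exact mean_const _ _

/-- The weights `2 ^ q` cancel the probabilities of the levels, and the differences telescope. -/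
lemma mean_stepLaw_mlmc (hT : Tmax ≠ 0) (f : Transition S A → V) (s : S) :
    mean (M.stepLaw π Tmax s) (fun x => mlmc Tmax f x.1 x.2) =
      mean (M.trajLaw π (2 ^ Nat.log 2 Tmax) s) (levelMean f · (Nat.log 2 Tmax)) := by
  rw [mean_stepLaw (M.bddOn_stepLaw_mlmc π Tmax f s),
    mean_congr fun q _ => mean_trajLaw_mlmc f q s,
    mean_add (BddOn.const _ _) (bddOn_levelLaw_ite Tmax _), mean_const, mean_levelLaw_ite hT]
  simp only [Nat.add_sub_cancel]
  rw [Finset.sum_range_sub fun j => mean (M.trajLaw π (2 ^ j) s) (levelMean f · j)]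
  abel

end FirstMoment

section Mixing

variable [Fintype S] [Fintype A] [DecidableEq S] {τ : ℕ}

lemma norm_mean_stepLaw_mlmc_sub_le (hT : Tmax ≠ 0) (hτ : M.MixedBy π τ)
    {f : Transition S A → V} {c : V} {G : ℝ} (hf : M.stationaryMean π (fun z => f z - c) = 0)
    (hG : ∀ z, ‖f z - c‖ ≤ G) (s : S) :
    ‖mean (M.stepLaw π Tmax s) (fun x => mlmc Tmax f x.1 x.2) - c‖ ≤ 4 * τ / Tmax * G := by
  set J := Nat.log 2 Tmax
  have hcentre : mean (M.trajLaw π (2 ^ J) s) (levelMean f · J) - c = ((2 : ℝ) ^ J)⁻¹ •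
      mean (M.trajLaw π (2 ^ J) s) (fun zs => (zs.map fun z => f z - c).sum) := by
    rw [← mean_smul _ (M.bddOn_trajLaw π _ s _), ← mean_const (M.trajLaw π (2 ^ J) s) c,
      ← mean_sub (M.bddOn_trajLaw π _ s _) (BddOn.const _ _), mean_const]
    refine mean_congr fun zs hzs => ?_
    have hl := M.length_of_mem_support_trajLaw π _ s hzs
    rw [← levelMean_sub_const f c hl.ge, levelMean_of_length_eq _ hl]
  have hsum := norm_mean_trajLaw_sum_le hτ hf hG (2 ^ J) s
  have hTJ : (Tmax : ℝ) ≤ 2 * 2 ^ J := by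
    rw [← pow_succ']
    exact_mod_cast (Nat.lt_pow_succ_log_self (by norm_num) Tmax).le
  have : (0 : ℝ) < Tmax := by exact_mod_cast Nat.pos_of_ne_zero hT
  rw [mean_stepLaw_mlmc hT, hcentre, norm_smul, norm_inv, norm_pow, Real.norm_ofNat]
  calc _ ≤ ((2 : ℝ) ^ J)⁻¹ * (2 * τ * G) := by gcongr
    _ ≤ (2 / Tmax) * (2 * τ * G) := by
        have := (norm_nonneg _).trans hsum
        gcongr
        rw [inv_le_comm₀ (by positivity) (by positivity), inv_div]
        linarith
    _ = 4 * τ / Tmax * G := by ring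

end Mixing

section SecondMoment

variable [Fintype S] [Fintype A] [DecidableEq S] {τ : ℕ} {V : Type*} [NormedAddCommGroup V]
  [InnerProductSpace ℝ V] [CompleteSpace V] {f : Transition S A → V} {G : ℝ}

lemma mean_trajLaw_levelMean_norm_sq_le (hτ : M.MixedBy π τ)
    (hf : M.stationaryMean π f = 0) (hG : ∀ z, ‖f z‖ ≤ G) {n j : ℕ} (h : 2 ^ j ≤ n) (s : S) :
    mean (M.trajLaw π n s) (fun zs => ‖levelMean f zs j‖ ^ 2) ≤ 5 * τ * G ^ 2 / 2 ^ j := by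
  rw [mean_trajLaw_levelMean f (fun v => ‖v‖ ^ 2) h]
  have hsum : ∀ zs ∈ (M.trajLaw π (2 ^ j) s).support,
      ‖levelMean f zs j‖ ^ 2 = ((2 : ℝ) ^ j)⁻¹ ^ 2 * ‖(zs.map f).sum‖ ^ 2 := by
    intro zs hzs
    rw [levelMean_of_length_eq _ (M.length_of_mem_support_trajLaw π _ s hzs), norm_smul, norm_inv,
      norm_pow, Real.norm_ofNat, mul_pow]
  rw [mean_congr hsum, mean_mul _ (M.bddOn_trajLaw π _ s _)]
  calc _ ≤ ((2 : ℝ) ^ j)⁻¹ ^ 2 * (5 * (2 ^ j : ℕ) * τ * G ^ 2) := by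
        gcongr
        exact mean_trajLaw_norm_sum_sq_le hτ hf hG (2 ^ j) s
    _ = 5 * τ * G ^ 2 / 2 ^ j := by
      push_cast
      field_simp

variable {c : V} {B : ℝ}

lemma mean_trajLaw_mlmc_norm_sq_le (hτ : M.MixedBy π τ) (hB : ∀ z, ‖f z‖ ≤ B)
    (hf : M.stationaryMean π (fun z => f z - c) = 0) (hG : ∀ z, ‖f z - c‖ ≤ G) {q : ℕ}
    (hq : 1 ≤ q) (s : S) :
    mean (M.trajLaw π (trajLength Tmax q) s) (fun zs => ‖mlmc Tmax f q zs‖ ^ 2) ≤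
      2 * B ^ 2 + if 2 ^ q ≤ Tmax then (2 : ℝ) ^ q • (60 * τ * G ^ 2) else 0 := by
  have hB0 : 0 ≤ B := (norm_nonneg _).trans (hB (s, (π s).support_nonempty.some, s))
  by_cases hqT : 2 ^ q ≤ Tmax
  · rw [trajLength, if_pos hqT, if_pos hqT]
    refine (mean_mono (M.bddOn_trajLaw π _ s _) (M.bddOn_trajLaw π _ s _) fun zs hzs =>
      norm_mlmc_sq_le hB0 hB c Tmax (M.length_of_mem_support_trajLaw π _ s hzs).ge).trans ?_
    simp only [hqT, if_true]
    rw [mean_add (BddOn.const _ _) (M.bddOn_trajLaw π _ s _), mean_const,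
      mean_mul _ (M.bddOn_trajLaw π _ s _),
      mean_add (M.bddOn_trajLaw π _ s _) (M.bddOn_trajLaw π _ s _)]
    have hfine := mean_trajLaw_levelMean_norm_sq_le hτ hf hG (le_refl (2 ^ q)) s
    have hcoarse := mean_trajLaw_levelMean_norm_sq_le hτ hf hG (j := q - 1) (n := 2 ^ q)
      (Nat.pow_le_pow_right (by norm_num) (Nat.sub_le q 1)) s
    obtain ⟨j, rfl⟩ : ∃ j, q = j + 1 := ⟨q - 1, (Nat.sub_add_cancel hq).symm⟩
    rw [Nat.add_sub_cancel] at *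
    calc _ ≤ 2 * B ^ 2 + 4 * (2 ^ (j + 1)) ^ 2 * (5 * τ * G ^ 2 / 2 ^ (j + 1) +
          5 * τ * G ^ 2 / 2 ^ j) := by gcongr
      _ = _ := by
        rw [smul_eq_mul, pow_succ]
        field_simp
        ring
  · simp only [mlmc, hqT, if_false, add_zero]
    refine mean_le (M.bddOn_trajLaw π _ s _) fun zs _ => ?_
    nlinarith [pow_le_pow_left₀ (norm_nonneg _) (norm_levelMean_le hB0 hB zs 0) 2]

lemma mean_stepLaw_mlmc_norm_sq_le (hT : Tmax ≠ 0) (hτ : M.MixedBy π τ) (hB : ∀ z, ‖f z‖ ≤ B)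
    (hf : M.stationaryMean π (fun z => f z - c) = 0) (hG : ∀ z, ‖f z - c‖ ≤ G) (s : S) :
    mean (M.stepLaw π Tmax s) (fun x => ‖mlmc Tmax f x.1 x.2‖ ^ 2) ≤
      2 * B ^ 2 + 60 * τ * G ^ 2 * Nat.log 2 Tmax := by
  have hbdd := (M.bddOn_stepLaw_mlmc π Tmax f s).norm_sq
  have hlevels := bddOn_levelLaw_ite Tmax fun q => (2 : ℝ) ^ q • (60 * τ * G ^ 2)
  rw [mean_stepLaw hbdd]
  calc _ ≤ mean levelLaw fun q =>
        2 * B ^ 2 + if 2 ^ q ≤ Tmax then (2 : ℝ) ^ q • (60 * τ * G ^ 2) else 0 :=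
        mean_mono (bddOn_mean_trajLaw hbdd) ((BddOn.const _ _).add hlevels) fun q hq =>
          mean_trajLaw_mlmc_norm_sq_le hτ hB hf hG (one_le_of_mem_support_levelLaw hq) s
    _ = _ := by
      rw [mean_add (BddOn.const _ _) hlevels, mean_const, mean_levelLaw_ite hT, Finset.sum_const,
        Finset.card_range, nsmul_eq_mul, mul_comm (Nat.log 2 Tmax : ℝ)]

end SecondMoment

end CMDP

/-! ### The inner loop -/

namespace CMDP

variable {S A : Type*} (M : CMDP S A) (π : S → PMF A) (Tmax : ℕ)

lemma innerLaw_succ (n : ℕ) (s : S) :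
    M.innerLaw π Tmax (n + 1) s = (M.stepLaw π Tmax s).bind fun x =>
      (M.innerLaw π Tmax n (trajEnd s x.2)).map fun xs => x :: xs := by
  rw [innerLaw, stepLaw, PMF.bind_bind]
  simp_rw [PMF.bind_map]
  rfl

lemma innerLaw_succ_last (n : ℕ) (s : S) :
    M.innerLaw π Tmax (n + 1) s = (M.innerLaw π Tmax n s).bind fun xs =>
      (M.stepLaw π Tmax (innerEnd s xs)).map fun x => xs ++ [x] := by
  induction n generalizing s with
  | zero =>
    rw [innerLaw_succ]
    simp only [innerLaw, PMF.pure_bind, PMF.pure_map]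
    rfl
  | succ n ih =>
    rw [innerLaw_succ, M.innerLaw_succ π Tmax n s, PMF.bind_bind]
    simp_rw [ih, PMF.map_bind, PMF.bind_map, PMF.map_comp]
    rfl

lemma length_of_mem_support_innerLaw (n : ℕ) (s : S) {xs : List (InnerSample S A)}
    (h : xs ∈ (M.innerLaw π Tmax n s).support) : xs.length = n := by
  induction n generalizing s xs with
  | zero =>
    rw [innerLaw, PMF.mem_support_pure_iff] at h
    simp [h]
  | succ n ih =>
    rw [innerLaw_succ, PMF.mem_support_bind_iff] at h
    obtain ⟨x, -, h⟩ := h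
    rw [PMF.mem_support_map_iff] at h
    obtain ⟨xs', h', rfl⟩ := h
    simp [ih _ h']

variable {M π Tmax} {V : Type*} [NormedAddCommGroup V] [NormedSpace ℝ V] [CompleteSpace V]
  {n : ℕ} {s : S} {F : List (InnerSample S A) → V}

lemma bddOn_mean_stepLaw (hF : BddOn (M.innerLaw π Tmax (n + 1) s) F) :
    BddOn (M.innerLaw π Tmax n s) fun xs =>
      mean (M.stepLaw π Tmax (innerEnd s xs)) fun x => F (xs ++ [x]) := by
  rw [innerLaw_succ_last] at hF
  obtain ⟨C, hC⟩ := hF.mean_bind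
  refine ⟨C, fun xs hxs => ?_⟩
  have h := hC xs hxs
  beta_reduce at h
  rwa [mean_map (hF.of_bind hxs).of_map] at h

lemma mean_innerLaw_succ (hF : BddOn (M.innerLaw π Tmax (n + 1) s) F) :
    mean (M.innerLaw π Tmax (n + 1) s) F = mean (M.innerLaw π Tmax n s) fun xs =>
      mean (M.stepLaw π Tmax (innerEnd s xs)) fun x => F (xs ++ [x]) := by
  rw [innerLaw_succ_last] at hF ⊢
  rw [mean_bind hF]
  exact mean_congr fun xs hxs => mean_map (hF.of_bind hxs).of_map

section StationaryMean

variable {S A : Type*} [Fintype S] [Fintype A] (M : CMDP S A) (π : S → PMF A)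

lemma map_stationaryMean {V W : Type*} [AddCommGroup V] [Module ℝ V] [AddCommGroup W] [Module ℝ W]
    (L : V →ₗ[ℝ] W) (f : Transition S A → V) :
    L (M.stationaryMean π f) = M.stationaryMean π fun z => L (f z) := by
  simp [stationaryMean, map_sum]

lemma stationaryMean_add {V : Type*} [AddCommGroup V] [Module ℝ V] (f g : Transition S A → V) :
    M.stationaryMean π (fun z => f z + g z) = M.stationaryMean π f + M.stationaryMean π g := by
  simp [stationaryMean, smul_add, Finset.sum_add_distrib]

lemma stationaryMean_sub {V : Type*} [AddCommGroup V] [Module ℝ V] (f g : Transition S A → V) :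
    M.stationaryMean π (fun z => f z - g z) = M.stationaryMean π f - M.stationaryMean π g := by
  simp [stationaryMean, smul_sub, Finset.sum_sub_distrib]

variable {V : Type*} [NormedAddCommGroup V] [NormedSpace ℝ V]

lemma stationaryMean_const (c : V) : M.stationaryMean π (fun _ => c) = c := by
  rw [stationaryMean_eq]
  simp_rw [stepMean, ← Finset.sum_smul, M.sum_weight, one_smul]
  rw [← Finset.sum_smul, (M.isStationary_stationary π).2.1, one_smul]

lemma norm_stationaryMean_le {f : Transition S A → V} {C : ℝ} (h : ∀ z, ‖f z‖ ≤ C) :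
    ‖M.stationaryMean π f‖ ≤ C := by
  obtain ⟨hnonneg, hsum, -⟩ := M.isStationary_stationary π
  rw [stationaryMean_eq]
  calc _ ≤ ∑ s, M.stationary π s * C := norm_sum_le_of_le _ fun s _ => by
        rw [norm_smul, Real.norm_of_nonneg (hnonneg s)]
        exact mul_le_mul_of_nonneg_left (M.norm_stepMean_le π h s) (hnonneg s)
    _ = C := by rw [← Finset.sum_mul, hsum, one_mul]

end StationaryMean

end CMDP

/-! ### Linear stochastic approximation with multi-level Monte Carlo estimates -/

lemma natLog_two_le {n : ℕ} (hn : n ≠ 0) : (Nat.log 2 n : ℝ) ≤ 3 / 2 * Real.log n := by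
  have hpow : (2 : ℝ) ^ Nat.log 2 n ≤ n := by exact_mod_cast Nat.pow_log_le_self 2 hn
  have hlog := Real.log_le_log (by positivity) hpow
  rw [Real.log_pow] at hlog
  nlinarith [Real.log_two_gt_d9, (Nat.cast_nonneg _ : (0 : ℝ) ≤ Nat.log 2 n)]

lemma one_le_log_of_three_le {n : ℕ} (hn : 3 ≤ n) : 1 ≤ Real.log n := by
  rw [Real.le_log_iff_exp_le (by positivity)]
  have : (3 : ℝ) ≤ n := by exact_mod_cast hn
  linarith [Real.exp_one_lt_d9]

lemma le_pow_mul_add {u : ℕ → ℝ} {ρ D : ℝ} (hρ : 0 ≤ ρ) (hD : 0 ≤ D)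
    (h : ∀ n, u (n + 1) ≤ ρ * u n + (1 - ρ) * D) (n : ℕ) : u n ≤ ρ ^ n * u 0 + D := by
  suffices u n - D ≤ ρ ^ n * (u 0 - D) by nlinarith [mul_nonneg (pow_nonneg hρ n) hD]
  induction n with
  | zero => simp
  | succ n ih =>
    rw [pow_succ']
    nlinarith [h n, mul_le_mul_of_nonneg_left ih hρ]

/-- The data of the stochastic approximation `x_{h+1} = x_h - γ v(x_h)` of a root of the mean of
`x ↦ L(z) x - b(z)`, where `v(x)` is the MLMC estimate of `L(z) x - b(z)`. -/
structure LinearScheme (S A V : Type*) [NormedAddCommGroup V] [NormedSpace ℝ V] where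
  L : Transition S A → V →L[ℝ] V
  b : Transition S A → V
  γ : ℝ
  Tmax : ℕ

namespace LinearScheme

section Basic

variable {S A V : Type*} [NormedAddCommGroup V] [NormedSpace ℝ V] (D : LinearScheme S A V)

/-- The one-sample direction `L(z) x - b(z)`. -/
def direction (x : V) (z : Transition S A) : V := D.L z x - D.b z

/-- One step `x - γ v(x)` of the scheme. -/
def step (x : V) (y : InnerSample S A) : V := x - D.γ • mlmc D.Tmax (D.direction x) y.1 y.2

/-- The iterate reached from `x₀` after the given inner-loop steps. -/
def iterate (x₀ : V) (xs : List (InnerSample S A)) : V := xs.foldl D.step x₀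

lemma iterate_append_singleton (x₀ : V) (xs : List (InnerSample S A)) (y : InnerSample S A) :
    D.iterate x₀ (xs ++ [y]) = D.step (D.iterate x₀ xs) y := by
  rw [iterate, List.foldl_append]
  rfl

/-- The level to which the mean square error of the iterates decreases when the rate is `1 - γ ρ`
and `R` bounds the residuals at the root: the truncation of the MLMC estimates contributes the
first term, their variance the second one. -/
def errorFloor (τ : ℕ) (ρ R : ℝ) : ℝ :=
  (128 * (τ / D.Tmax / ρ) ^ 2 + 184 * (D.γ * (τ * Real.log D.Tmax) / ρ)) * R ^ 2

lemma direction_eq_add (x y : V) (z : Transition S A) :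
    D.direction x z = D.L z (x - y) + D.direction y z := by
  simp only [direction, map_sub]
  abel

variable [Finite S] [Finite A]

lemma exists_norm_iterate_le (x₀ : V) (n : ℕ) :
    ∃ C, ∀ xs : List (InnerSample S A), xs.length = n → ‖D.iterate x₀ xs‖ ≤ C := by
  obtain ⟨a, ha⟩ := (Set.finite_range fun z => ‖D.L z‖).bddAbove
  obtain ⟨b, hb⟩ := (Set.finite_range fun z => ‖D.b z‖).bddAbove
  induction n with
  | zero => exact ⟨‖x₀‖, fun xs hxs => by rw [List.length_eq_zero_iff.1 hxs]; rfl⟩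
  | succ n ih =>
    obtain ⟨C, hC⟩ := ih
    refine ⟨C + |D.γ| * ((1 + 2 * D.Tmax) * (|a| * |C| + |b|)), fun xs hxs => ?_⟩
    obtain ⟨ys, y, rfl⟩ := List.eq_nil_or_concat' xs |>.resolve_left (by rintro rfl; simp at hxs)
    have hys := hC ys (by simpa using hxs)
    have hdir : ∀ z, ‖D.direction (D.iterate x₀ ys) z‖ ≤ |a| * |C| + |b| := fun z =>
      norm_sub_le_of_le
        ((D.L z).le_of_opNorm_le_of_le ((ha ⟨z, rfl⟩).trans (le_abs_self a))
          (hys.trans (le_abs_self C)))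
        ((hb ⟨z, rfl⟩).trans (le_abs_self b))
    rw [iterate_append_singleton, step]
    refine norm_sub_le_of_le hys ?_
    rw [norm_smul, Real.norm_eq_abs]
    exact mul_le_mul_of_nonneg_left (norm_mlmc_le (by positivity) hdir _ _ _) (abs_nonneg _)

lemma bddOn_iterate (M : CMDP S A) (π : S → PMF A) (Tmax n : ℕ) (s : S) (x₀ : V) :
    BddOn (M.innerLaw π Tmax n s) (D.iterate x₀) := by
  obtain ⟨C, hC⟩ := D.exists_norm_iterate_le x₀ n
  exact ⟨C, fun xs hxs => hC xs (M.length_of_mem_support_innerLaw π _ n s hxs)⟩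

end Basic

section Bias

variable {S A V : Type*} [Fintype S] [Fintype A] [NormedAddCommGroup V] [NormedSpace ℝ V]
  (D : LinearScheme S A V) (M : CMDP S A) (π : S → PMF A)

/-- The bias, as an estimate of its stationary mean, of the MLMC estimate of `L(z) x - b(z)` drawn
from the state `s`. -/
def bias (root x : V) (s : S) : V :=
  mean (M.stepLaw π D.Tmax s) (fun y => mlmc D.Tmax (D.direction x) y.1 y.2) -
    M.stationaryMean π D.L (x - root)

lemma mean_step [CompleteSpace V] (root x : V) (s : S) :
    mean (M.stepLaw π D.Tmax s) (D.step x) =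
      x - D.γ • (M.stationaryMean π D.L (x - root) + D.bias M π root x s) := by
  have hbdd := M.bddOn_stepLaw_mlmc π D.Tmax (D.direction x) s
  rw [bias, add_sub_cancel, ← mean_smul _ hbdd]
  exact (mean_sub (BddOn.const _ x) (hbdd.const_smul _)).trans (by rw [mean_const])

end Bias

section Analysis

variable {S A V : Type*} [Fintype S] [Fintype A] [DecidableEq S] [NormedAddCommGroup V]
  [InnerProductSpace ℝ V] {D : LinearScheme S A V}
  {M : CMDP S A} {π : S → PMF A} {τ : ℕ} {root : V} {ρ a σ R : ℝ}

/-- The scheme `D` has the mean root `root` and satisfies the bounds under which it converges to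
it at the rate `1 - γ ρ` in mean square: `a` bounds the operators, `σ` their fluctuation, and `R`
the residuals at the root. The excess of the coercivity constant over `ρ / 2` absorbs the bias
and the variance of the estimates. -/
structure IsAdmissible (D : LinearScheme S A V) (M : CMDP S A) (π : S → PMF A) (τ : ℕ) (root : V)
    (ρ a σ R : ℝ) : Prop where
  mixed : M.MixedBy π τ
  stationaryMean_root : M.stationaryMean π (D.direction root) = 0
  coercive : ∀ x, 3 / 4 * ρ * ‖x‖ ^ 2 ≤ inner ℝ x (M.stationaryMean π D.L x)
  norm_L_le : ∀ z, ‖D.L z‖ ≤ a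
  norm_L_sub_le : ∀ z, ‖D.L z - M.stationaryMean π D.L‖ ≤ σ
  norm_residual_le : ∀ z, ‖D.direction root z‖ ≤ R
  rate_pos : 0 < ρ
  rate_le : ρ ≤ a
  step_nonneg : 0 ≤ D.γ
  three_le_Tmax : 3 ≤ D.Tmax
  truncation : 64 * σ * τ ≤ ρ * D.Tmax
  step_le : 16 * D.γ * (τ * Real.log D.Tmax) * (a ^ 2 + 45 * σ ^ 2) ≤ ρ

namespace IsAdmissible

variable (h : D.IsAdmissible M π τ root ρ a σ R)

include h

lemma fluctuation_nonneg : 0 ≤ σ := by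
  obtain ⟨s⟩ := M.nonempty_state
  exact (norm_nonneg _).trans (h.norm_L_sub_le (s, (π s).support_nonempty.some, s))

lemma one_le_mixing_mul_log : 1 ≤ τ * Real.log D.Tmax :=
  one_le_mul_of_one_le_of_one_le (by exact_mod_cast h.mixed.one_le)
    (one_le_log_of_three_le h.three_le_Tmax)

lemma step_mul_le : 16 * D.γ * (a ^ 2 + 45 * σ ^ 2) ≤ ρ := by
  refine le_trans ?_ h.step_le
  have := h.step_nonneg
  rw [mul_right_comm _ ((τ : ℝ) * _)]
  exact le_mul_of_one_le_right (by positivity) h.one_le_mixing_mul_log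

lemma step_mul_rate_le_one : D.γ * ρ ≤ 1 := by
  have ha := h.rate_pos.trans_le h.rate_le
  have := h.step_nonneg
  have hmul : 16 * (D.γ * a) * a ≤ 1 * a := by
    nlinarith [h.step_mul_le, h.rate_le, mul_nonneg this (sq_nonneg σ)]
  have hstep := le_of_mul_le_mul_right hmul ha
  nlinarith [mul_le_mul_of_nonneg_left h.rate_le this, mul_nonneg this ha.le]

lemma errorFloor_nonneg : 0 ≤ D.errorFloor τ ρ R := by
  have := h.step_nonneg
  have := h.rate_pos
  have := h.one_le_mixing_mul_log
  rw [errorFloor]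
  positivity

lemma fluctuation_mul_ratio_le : σ * (τ / D.Tmax / ρ) ≤ 1 / 64 := by
  have hT : (0 : ℝ) < D.Tmax := by exact_mod_cast (by norm_num : 0 < 3).trans_le h.three_le_Tmax
  have hρ := h.rate_pos
  rw [div_div, mul_div_assoc', div_le_iff₀ (by positivity)]
  linarith [h.truncation]

lemma sq_fluctuation_mul_errorFloor_le : σ ^ 2 * D.errorFloor τ ρ R ≤ R ^ 2 := by
  have hρ := h.rate_pos
  have hvar : σ ^ 2 * (D.γ * (τ * Real.log D.Tmax) / ρ) ≤ 1 / 720 := by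
    rw [mul_div_assoc', div_le_iff₀ hρ]
    have hq := zero_le_one.trans h.one_le_mixing_mul_log
    nlinarith [h.step_le, mul_nonneg (mul_nonneg h.step_nonneg hq) (sq_nonneg a)]
  have hbias : (σ * (τ / D.Tmax / ρ)) ^ 2 ≤ (1 / 64) ^ 2 := by
    have := h.fluctuation_nonneg
    have := h.fluctuation_mul_ratio_le
    gcongr
  rw [errorFloor, ← mul_assoc]
  exact mul_le_of_le_one_left (sq_nonneg R) (by linarith [mul_pow σ (τ / D.Tmax / ρ) 2])

lemma quadratic_step_le {e p i w : ℝ} (hp : 3 / 4 * ρ * e ^ 2 ≤ p)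
    (hbias : -(4 * (τ / D.Tmax) * (σ * e + R)) * e ≤ i - p)
    (hw : w ≤ τ * Real.log D.Tmax * (4 * (a ^ 2 + 45 * σ ^ 2) * e ^ 2 + 184 * R ^ 2)) :
    e ^ 2 + (-(2 * D.γ) * i + D.γ ^ 2 * w) ≤
      (1 - D.γ * ρ) * e ^ 2 + D.γ * ρ * D.errorFloor τ ρ R := by
  have hρ := h.rate_pos
  have hγ := h.step_nonneg
  have hratio : (τ : ℝ) / D.Tmax = ρ * (τ / D.Tmax / ρ) := by field_simp
  have hfloor : D.γ * ρ * D.errorFloor τ ρ R = D.γ * ρ * (128 * (τ / D.Tmax / ρ) ^ 2 * R ^ 2) +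
      D.γ ^ 2 * (τ * Real.log D.Tmax * (184 * R ^ 2)) := by
    rw [errorFloor]
    field_simp
  have hσ := h.fluctuation_mul_ratio_le
  rw [hratio] at hbias
  rw [hfloor]
  generalize (τ : ℝ) / D.Tmax / ρ = t at *
  have hdrift : -(2 * D.γ) * i ≤ D.γ * ρ *
      (-(3 / 2) * e ^ 2 + 8 * (σ * t) * e ^ 2 + 8 * t * R * e) := by
    nlinarith [mul_le_mul_of_nonneg_left (add_le_add hp hbias) hγ]
  have hvar : D.γ ^ 2 * w ≤ D.γ * ρ * (1 / 4 * e ^ 2) +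
      D.γ ^ 2 * (τ * Real.log D.Tmax * (184 * R ^ 2)) := by
    nlinarith [mul_le_mul_of_nonneg_left hw (sq_nonneg D.γ),
      mul_le_mul_of_nonneg_left h.step_le (mul_nonneg hγ (sq_nonneg e))]
  have hcross : 8 * (σ * t) * e ^ 2 + 8 * t * R * e ≤ 1 / 4 * e ^ 2 + 128 * t ^ 2 * R ^ 2 := by
    nlinarith [mul_le_mul_of_nonneg_right hσ (sq_nonneg e),
      sq_nonneg (e - 32 * t * R)]
  nlinarith [mul_le_mul_of_nonneg_left hcross (mul_nonneg hγ hρ.le)]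

lemma stationaryMean_direction_sub (x : V) :
    M.stationaryMean π (fun z => D.direction x z - M.stationaryMean π D.L (x - root)) = 0 := by
  have happly := M.map_stationaryMean π
    (ContinuousLinearMap.apply ℝ V (x - root)).toLinearMap D.L
  rw [M.stationaryMean_sub, M.stationaryMean_const, sub_eq_zero,
    funext (D.direction_eq_add x root), M.stationaryMean_add, h.stationaryMean_root, add_zero]
  exact happly.symm

lemma norm_direction_le (x : V) (z : Transition S A) :
    ‖D.direction x z‖ ≤ a * ‖x - root‖ + R := by
  rw [D.direction_eq_add x root]
  exact norm_add_le_of_le ((D.L z).le_of_opNorm_le (h.norm_L_le z) _) (h.norm_residual_le z)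

lemma norm_direction_sub_le (x : V) (z : Transition S A) :
    ‖D.direction x z - M.stationaryMean π D.L (x - root)‖ ≤ σ * ‖x - root‖ + R := by
  rw [D.direction_eq_add x root, add_sub_right_comm, ← sub_apply]
  exact norm_add_le_of_le (ContinuousLinearMap.le_of_opNorm_le _ (h.norm_L_sub_le z) _)
    (h.norm_residual_le z)

lemma norm_sub_smul_sq_le (x β : V) :
    ‖x - D.γ • (M.stationaryMean π D.L x + β)‖ ^ 2 ≤
      (1 - D.γ * ρ) * ‖x‖ ^ 2 + D.γ * ρ * (6 / ρ ^ 2 * ‖β‖ ^ 2) := by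
  have hρ := h.rate_pos
  have hγ := h.step_nonneg
  have hnorm : ‖M.stationaryMean π D.L x + β‖ ^ 2 ≤ 2 * a ^ 2 * ‖x‖ ^ 2 + 2 * ‖β‖ ^ 2 := by
    have := norm_add_le_of_le
      (ContinuousLinearMap.le_of_opNorm_le _ (M.norm_stationaryMean_le π h.norm_L_le) x)
      (le_refl ‖β‖)
    nlinarith [pow_le_pow_left₀ (norm_nonneg _) this 2, sq_nonneg (a * ‖x‖ - ‖β‖)]
  have hcross : -(ρ / 8 * ‖x‖ ^ 2 + 2 / ρ * ‖β‖ ^ 2) ≤ inner ℝ x β := by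
    refine le_trans ?_ (neg_le_of_abs_le (abs_real_inner_le_norm x β))
    have : ρ / 8 * ‖x‖ ^ 2 + 2 / ρ * ‖β‖ ^ 2 - ‖x‖ * ‖β‖ = (ρ * ‖x‖ - 4 * ‖β‖) ^ 2 / (8 * ρ) := by
      field_simp
      ring
    linarith [div_nonneg (sq_nonneg (ρ * ‖x‖ - 4 * ‖β‖)) (by positivity : 0 ≤ 8 * ρ)]
  have hperturb : D.γ * ρ * (6 / ρ ^ 2 * ‖β‖ ^ 2) = D.γ * (3 * (2 / ρ * ‖β‖ ^ 2)) := by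
    field_simp
    ring
  have hγρ : D.γ * ‖β‖ ^ 2 ≤ 1 / 2 * (2 / ρ * ‖β‖ ^ 2) := by
    have : 1 / 2 * (2 / ρ * ‖β‖ ^ 2) = 1 / ρ * ‖β‖ ^ 2 := by ring
    rw [this]
    gcongr
    exact (le_div_iff₀ hρ).2 h.step_mul_rate_le_one
  have hγa : 16 * D.γ * a ^ 2 ≤ ρ := by
    nlinarith [h.step_mul_le, mul_nonneg hγ (sq_nonneg σ)]
  rw [norm_sub_sq_real, real_inner_smul_right, inner_add_right, norm_smul, mul_pow,
    Real.norm_eq_abs, sq_abs, hperturb]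
  nlinarith [mul_le_mul_of_nonneg_left (add_le_add (h.coercive x) hcross) hγ,
    mul_le_mul_of_nonneg_left hnorm (sq_nonneg D.γ),
    mul_le_mul_of_nonneg_left hγρ hγ, mul_nonneg (mul_nonneg hγ hρ.le) (sq_nonneg ‖x‖),
    mul_le_mul_of_nonneg_left hγa (mul_nonneg hγ (sq_nonneg ‖x‖))]

variable [CompleteSpace V]

lemma norm_bias_le (x : V) (s : S) :
    ‖D.bias M π root x s‖ ≤ 4 * (τ / D.Tmax) * (σ * ‖x - root‖ + R) := by
  refine (CMDP.norm_mean_stepLaw_mlmc_sub_le (by have := h.three_le_Tmax; omega) h.mixed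
    (h.stationaryMean_direction_sub x) (h.norm_direction_sub_le x) s).trans_eq ?_
  ring

lemma mean_norm_mlmc_sq_le (x : V) (s : S) :
    mean (M.stepLaw π D.Tmax s) (fun y => ‖mlmc D.Tmax (D.direction x) y.1 y.2‖ ^ 2) ≤
      τ * Real.log D.Tmax *
        (4 * (a ^ 2 + 45 * σ ^ 2) * ‖x - root‖ ^ 2 + 184 * R ^ 2) := by
  have hT : D.Tmax ≠ 0 := by have := h.three_le_Tmax; omega
  refine (CMDP.mean_stepLaw_mlmc_norm_sq_le hT h.mixed (h.norm_direction_le x)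
    (h.stationaryMean_direction_sub x) (h.norm_direction_sub_le x) s).trans ?_
  have hlog : τ * (σ * ‖x - root‖ + R) ^ 2 * Nat.log 2 D.Tmax ≤
      τ * (σ * ‖x - root‖ + R) ^ 2 * (3 / 2 * Real.log D.Tmax) := by
    gcongr
    exact natLog_two_le hT
  have hq := h.one_le_mixing_mul_log
  have hB : 2 * (a * ‖x - root‖ + R) ^ 2 ≤
      τ * Real.log D.Tmax * (4 * (a ^ 2 * ‖x - root‖ ^ 2 + R ^ 2)) :=
    (by nlinarith [sq_nonneg (a * ‖x - root‖ - R)] :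
      _ ≤ 4 * (a ^ 2 * ‖x - root‖ ^ 2 + R ^ 2)).trans
      (le_mul_of_one_le_left (by positivity) hq)
  nlinarith [mul_nonneg (zero_le_one.trans hq) (sq_nonneg (σ * ‖x - root‖ - R))]

lemma mean_norm_step_sub_sq_le (x : V) (s : S) :
    mean (M.stepLaw π D.Tmax s) (fun y => ‖D.step x y - root‖ ^ 2) ≤
      (1 - D.γ * ρ) * ‖x - root‖ ^ 2 + D.γ * ρ * D.errorFloor τ ρ R := by
  set e := x - root
  set v := fun y : InnerSample S A => mlmc D.Tmax (D.direction x) y.1 y.2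
  have hbdd : BddOn (M.stepLaw π D.Tmax s) v := M.bddOn_stepLaw_mlmc π D.Tmax _ s
  have hexpand : ∀ y, ‖D.step x y - root‖ ^ 2 =
      ‖e‖ ^ 2 + (-(2 * D.γ) * inner ℝ e (v y) + D.γ ^ 2 * ‖v y‖ ^ 2) := fun y => by
    rw [step, sub_right_comm, norm_sub_sq_real, real_inner_smul_right, norm_smul, mul_pow,
      Real.norm_eq_abs, sq_abs]
    ring
  have hmean : mean (M.stepLaw π D.Tmax s) (fun y => ‖D.step x y - root‖ ^ 2) =
      ‖e‖ ^ 2 + (-(2 * D.γ) * inner ℝ e (mean (M.stepLaw π D.Tmax s) v) +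
        D.γ ^ 2 * mean (M.stepLaw π D.Tmax s) fun y => ‖v y‖ ^ 2) := by
    have hin := (hbdd.inner_left e).const_mul (-(2 * D.γ))
    have hsq := hbdd.norm_sq.const_mul (D.γ ^ 2)
    simp_rw [hexpand]
    rw [mean_add (BddOn.const _ _) (hin.add hsq), mean_const, mean_add hin hsq,
      mean_mul _ (hbdd.inner_left e), mean_mul _ hbdd.norm_sq, mean_inner_left _ hbdd]
  have hbias : -(4 * (τ / D.Tmax) * (σ * ‖e‖ + R)) * ‖e‖ ≤ inner ℝ e (D.bias M π root x s) := by
    have hCS := neg_le_of_abs_le (abs_real_inner_le_norm e (D.bias M π root x s))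
    nlinarith [norm_nonneg e, h.norm_bias_le x s]
  rw [bias, inner_sub_right] at hbias
  rw [hmean]
  exact h.quadratic_step_le (h.coercive e) hbias (h.mean_norm_mlmc_sq_le x s)

variable (n : ℕ) (s : S) (x₀ : V)

lemma mean_norm_iterate_sub_sq_le :
    mean (M.innerLaw π D.Tmax n s) (fun xs => ‖D.iterate x₀ xs - root‖ ^ 2) ≤
      (1 - D.γ * ρ) ^ n * ‖x₀ - root‖ ^ 2 + D.errorFloor τ ρ R := by
  have hbdd : ∀ n, BddOn (M.innerLaw π D.Tmax n s) fun xs => ‖D.iterate x₀ xs - root‖ ^ 2 :=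
    fun n => ((D.bddOn_iterate M π _ n s x₀).sub (BddOn.const _ _)).norm_sq
  have hrec := le_pow_mul_add
    (u := fun n => mean (M.innerLaw π D.Tmax n s) fun xs => ‖D.iterate x₀ xs - root‖ ^ 2)
    (sub_nonneg.2 h.step_mul_rate_le_one) h.errorFloor_nonneg (fun n => ?_) n
  · simpa only [CMDP.innerLaw, mean_pure, iterate, List.foldl_nil] using hrec
  · rw [sub_sub_cancel, CMDP.mean_innerLaw_succ (hbdd _), ← mean_mul _ (hbdd n),
      ← mean_const (M.innerLaw π D.Tmax n s) (D.γ * ρ * _),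
      ← mean_add ((hbdd n).const_mul _) (BddOn.const _ _)]
    refine mean_mono (CMDP.bddOn_mean_stepLaw (hbdd _))
      (((hbdd n).const_mul _).add (BddOn.const _ _)) fun xs _ => ?_
    simp_rw [iterate_append_singleton]
    exact h.mean_norm_step_sub_sq_le _ _

lemma bddOn_bias :
    BddOn (M.innerLaw π D.Tmax n s) fun xs =>
      D.bias M π root (D.iterate x₀ xs) (innerEnd s xs) := by
  have := h.fluctuation_nonneg
  obtain ⟨C, hC⟩ := (D.bddOn_iterate M π D.Tmax n s x₀).sub (BddOn.const _ root)
  refine ⟨4 * (τ / D.Tmax) * (σ * C + R), fun xs hxs => (h.norm_bias_le _ _).trans ?_⟩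
  gcongr
  exact hC xs hxs

lemma mean_iterate_succ_sub :
    mean (M.innerLaw π D.Tmax (n + 1) s) (D.iterate x₀) - root =
      mean (M.innerLaw π D.Tmax n s) (D.iterate x₀) - root -
        D.γ • (M.stationaryMean π D.L (mean (M.innerLaw π D.Tmax n s) (D.iterate x₀) - root) +
          mean (M.innerLaw π D.Tmax n s) fun xs =>
            D.bias M π root (D.iterate x₀ xs) (innerEnd s xs)) := by
  have hiter := fun n => D.bddOn_iterate M π D.Tmax n s x₀
  have herr := (hiter n).sub (BddOn.const _ root)
  have hbias := h.bddOn_bias n s x₀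
  rw [CMDP.mean_innerLaw_succ (hiter _)]
  simp_rw [iterate_append_singleton, D.mean_step M π root]
  rw [mean_sub (hiter n) (((herr.clm _).add hbias).const_smul _),
    mean_smul _ ((herr.clm _).add hbias), mean_add (herr.clm _) hbias, mean_clm _ herr,
    mean_sub (hiter n) (BddOn.const _ root), mean_const]
  exact sub_right_comm _ _ _

lemma norm_mean_bias_sq_le :
    ‖mean (M.innerLaw π D.Tmax n s) fun xs =>
        D.bias M π root (D.iterate x₀ xs) (innerEnd s xs)‖ ^ 2 ≤
      64 * (τ / D.Tmax) ^ 2 * (σ ^ 2 * ‖x₀ - root‖ ^ 2 + R ^ 2) := by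
  have hiter := ((D.bddOn_iterate M π D.Tmax n s x₀).sub (BddOn.const _ root)).norm_sq
  have hbias := h.bddOn_bias n s x₀
  have hpoint : ∀ xs, ‖D.bias M π root (D.iterate x₀ xs) (innerEnd s xs)‖ ^ 2 ≤
      32 * (τ / D.Tmax) ^ 2 * (R ^ 2 + σ ^ 2 * ‖D.iterate x₀ xs - root‖ ^ 2) := fun xs =>
    calc _ ≤ (4 * (τ / D.Tmax) * (σ * ‖D.iterate x₀ xs - root‖ + R)) ^ 2 :=
          pow_le_pow_left₀ (norm_nonneg _) (h.norm_bias_le _ _) 2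
      _ ≤ _ := by
        nlinarith [mul_nonneg (sq_nonneg ((τ : ℝ) / D.Tmax))
          (sq_nonneg (σ * ‖D.iterate x₀ xs - root‖ - R))]
  have hpow : (1 - D.γ * ρ) ^ n ≤ 1 := pow_le_one₀ (sub_nonneg.2 h.step_mul_rate_le_one)
    (sub_le_self _ (mul_nonneg h.step_nonneg h.rate_pos.le))
  have hmean : σ ^ 2 * mean (M.innerLaw π D.Tmax n s) (fun xs => ‖D.iterate x₀ xs - root‖ ^ 2) ≤
      σ ^ 2 * ‖x₀ - root‖ ^ 2 + R ^ 2 := by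
    nlinarith [mul_le_mul_of_nonneg_left (h.mean_norm_iterate_sub_sq_le n s x₀) (sq_nonneg σ),
      mul_le_mul_of_nonneg_right hpow (mul_nonneg (sq_nonneg σ) (sq_nonneg ‖x₀ - root‖)),
      h.sq_fluctuation_mul_errorFloor_le]
  have hbound := (BddOn.const (M.innerLaw π D.Tmax n s) (R ^ 2)).add (hiter.const_mul (σ ^ 2))
  refine (sq_norm_mean_le hbias).trans <| (mean_mono hbias.norm_sq (hbound.const_mul _)
    fun xs _ => hpoint xs).trans ?_
  rw [mean_mul _ hbound, mean_add (BddOn.const _ _) (hiter.const_mul _), mean_const,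
    mean_mul _ hiter]
  nlinarith [mul_le_mul_of_nonneg_left hmean (sq_nonneg ((τ : ℝ) / D.Tmax)),
    mul_nonneg (sq_nonneg ((τ : ℝ) / D.Tmax)) (mul_nonneg (sq_nonneg σ) (sq_nonneg ‖x₀ - root‖))]

lemma norm_mean_iterate_sub_sq_le :
    ‖mean (M.innerLaw π D.Tmax n s) (D.iterate x₀) - root‖ ^ 2 ≤
      (1 - D.γ * ρ) ^ n * ‖x₀ - root‖ ^ 2 +
        384 * (τ / D.Tmax / ρ) ^ 2 * (σ ^ 2 * ‖x₀ - root‖ ^ 2 + R ^ 2) := by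
  have hrec := le_pow_mul_add
    (u := fun n => ‖mean (M.innerLaw π D.Tmax n s) (D.iterate x₀) - root‖ ^ 2)
    (D := 384 * (τ / D.Tmax / ρ) ^ 2 * (σ ^ 2 * ‖x₀ - root‖ ^ 2 + R ^ 2))
    (sub_nonneg.2 h.step_mul_rate_le_one) (by positivity) (fun n => ?_) n
  · simpa only [CMDP.innerLaw, mean_pure, iterate, List.foldl_nil] using hrec
  · have hρ := h.rate_pos
    have hγ := h.step_nonneg
    rw [h.mean_iterate_succ_sub]
    refine (h.norm_sub_smul_sq_le _ _).trans ?_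
    rw [sub_sub_cancel]
    refine add_le_add le_rfl (mul_le_mul_of_nonneg_left ?_ (by positivity))
    calc _ ≤ 6 / ρ ^ 2 * (64 * (τ / D.Tmax) ^ 2 * (σ ^ 2 * ‖x₀ - root‖ ^ 2 + R ^ 2)) := by
          exact mul_le_mul_of_nonneg_left (h.norm_mean_bias_sq_le n s x₀) (by positivity)
      _ = _ := by
        field_simp
        ring

end IsAdmissible

end Analysis

end LinearScheme

/-! ### The critic -/

section Block

variable {m : ℕ}

/-- The vector `[η, ζ]`. -/
def block (η : ℝ) (ζ : EuclideanSpace ℝ (Fin m)) : CriticSpace m :=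
  WithLp.toLp 2 (Sum.elim (fun _ => η) fun i => ζ i)

/-- The weights `ζ` of `ξ = [η, ζ]`. -/
def weights (ξ : CriticSpace m) : EuclideanSpace ℝ (Fin m) :=
  WithLp.toLp 2 fun i => ξ (Sum.inr i)

lemma norm_sq_eq_add (ξ : CriticSpace m) : ‖ξ‖ ^ 2 = ξ (Sum.inl ()) ^ 2 + ‖weights ξ‖ ^ 2 := by
  simp [EuclideanSpace.norm_sq_eq, weights]

lemma weights_block (η : ℝ) (ζ : EuclideanSpace ℝ (Fin m)) : weights (block η ζ) = ζ := rfl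

lemma inner_block (ξ : CriticSpace m) (η : ℝ) (ζ : EuclideanSpace ℝ (Fin m)) :
    inner ℝ ξ (block η ζ) = ξ (Sum.inl ()) * η + inner ℝ (weights ξ) ζ := by
  simp [PiLp.inner_apply, block, weights, mul_comm]

lemma abs_inl_le (ξ : CriticSpace m) : |ξ (Sum.inl ())| ≤ ‖ξ‖ :=
  abs_le_of_sq_le_sq (by rw [norm_sq_eq_add]; linarith [sq_nonneg ‖weights ξ‖]) (norm_nonneg _)

lemma norm_weights_le (ξ : CriticSpace m) : ‖weights ξ‖ ≤ ‖ξ‖ :=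
  le_of_sq_le_sq (by rw [norm_sq_eq_add]; linarith [sq_nonneg (ξ (Sum.inl ()))]) (norm_nonneg _)

lemma norm_block_zero_right (η : ℝ) : ‖block η (0 : EuclideanSpace ℝ (Fin m))‖ = |η| := by
  rw [← Real.sqrt_sq (norm_nonneg (block η _)), norm_sq_eq_add, weights_block,
    ← Real.sqrt_sq_eq_abs]
  simp [block]

lemma norm_block_zero_left (ζ : EuclideanSpace ℝ (Fin m)) : ‖block 0 ζ‖ = ‖ζ‖ := by
  rw [← Real.sqrt_sq (norm_nonneg (block 0 ζ)), norm_sq_eq_add, ← Real.sqrt_sq (norm_nonneg ζ),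
    weights_block]
  simp [block]

end Block

lemma CMDP.abs_signal_le {S A : Type*} (M : CMDP S A) (g : Signal) (s : S) (a : A) :
    |M.signal g s a| ≤ 1 := by
  cases g
  · exact abs_le.2 ⟨neg_one_lt_zero.le.trans (M.r_mem s a).1, (M.r_mem s a).2⟩
  · exact abs_le.2 (M.c_mem s a)

section OneSample

variable {S A : Type*} {m : ℕ} (φ : Signal → S → EuclideanSpace ℝ (Fin m)) (cγ : ℝ) (g : Signal)

/-- The one-sample critic operator `ξ ↦ A_g(z) ξ`. -/
def criticOpAt (z : Transition S A) : CriticSpace m →L[ℝ] CriticSpace m :=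
  Matrix.toEuclideanCLM (𝕜 := ℝ) (CMDP.criticMatrixAt φ cγ g z)

/-- The part of `A_g(z) ξ` that depends on the transition. -/
def criticNoise (ξ : CriticSpace m) (z : Transition S A) : CriticSpace m :=
  block 0 ((ξ (Sum.inl ()) + inner ℝ (weights ξ) (φ g z.1 - φ g z.2.2)) • φ g z.1)

lemma criticOpAt_apply (z : Transition S A) (ξ : CriticSpace m) :
    criticOpAt φ cγ g z ξ = block (cγ * ξ (Sum.inl ())) 0 + criticNoise φ g ξ z := by
  ext i
  rcases i with i | i
  · simp [criticOpAt, CMDP.criticMatrixAt, block, criticNoise, Matrix.fromBlocks, Matrix.mulVec,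
      dotProduct]
  · suffices φ g z.1 i * ξ (Sum.inl ()) +
        ∑ j, φ g z.1 i * (φ g z.1 j - φ g z.2.2 j) * ξ (Sum.inr j) =
        (ξ (Sum.inl ()) + ∑ j, (φ g z.1 j - φ g z.2.2 j) * ξ (Sum.inr j)) * φ g z.1 i by
      simpa [criticOpAt, CMDP.criticMatrixAt, block, criticNoise, weights, Matrix.fromBlocks,
        Matrix.mulVec, dotProduct, PiLp.inner_apply]
    rw [add_mul, Finset.sum_mul, mul_comm]
    exact congrArg _ (Finset.sum_congr rfl fun j _ => by ring)

lemma inner_criticOpAt (z : Transition S A) (ξ : CriticSpace m) :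
    inner ℝ ξ (criticOpAt φ cγ g z ξ) = cγ * ξ (Sum.inl ()) ^ 2 +
      (ξ (Sum.inl ()) * inner ℝ (weights ξ) (φ g z.1) +
        inner ℝ (weights ξ) (φ g z.1) * inner ℝ (weights ξ) (φ g z.1 - φ g z.2.2)) := by
  rw [criticOpAt_apply, criticNoise, inner_add_right, inner_block, inner_block, inner_smul_right,
    inner_zero_right]
  ring

lemma toLp_criticVectorAt (M : CMDP S A) (z : Transition S A) :
    (WithLp.toLp 2 (M.criticVectorAt φ cγ g z) : CriticSpace m) =
      block (cγ * M.signal g z.1 z.2.1) 0 + block 0 (M.signal g z.1 z.2.1 • φ g z.1) := by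
  ext i
  rcases i with i | i <;> simp [CMDP.criticVectorAt, block]

variable {φ cγ g}

lemma norm_criticNoise_le (hφ : ∀ s, ‖φ g s‖ ≤ 1) (ξ : CriticSpace m) (z : Transition S A) :
    ‖criticNoise φ g ξ z‖ ≤ 3 * ‖ξ‖ := by
  rw [criticNoise, norm_block_zero_left, norm_smul, Real.norm_eq_abs]
  have hdiff : ‖φ g z.1 - φ g z.2.2‖ ≤ 2 := (norm_sub_le_of_le (hφ _) (hφ _)).trans (by norm_num)
  have hinner : |inner ℝ (weights ξ) (φ g z.1 - φ g z.2.2)| ≤ ‖ξ‖ * 2 :=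
    (abs_real_inner_le_norm _ _).trans
      (mul_le_mul (norm_weights_le ξ) hdiff (norm_nonneg _) (norm_nonneg _))
  refine (mul_le_of_le_one_right (abs_nonneg _) (hφ _)).trans ((abs_add_le _ _).trans ?_)
  linarith [abs_inl_le ξ]

lemma norm_criticOpAt_le (hφ : ∀ s, ‖φ g s‖ ≤ 1) (hc : 0 ≤ cγ) (z : Transition S A) :
    ‖criticOpAt φ cγ g z‖ ≤ cγ + 3 := by
  refine ContinuousLinearMap.opNorm_le_bound _ (by positivity) fun ξ => ?_
  rw [criticOpAt_apply, add_mul]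
  refine norm_add_le_of_le ?_ (norm_criticNoise_le hφ ξ z)
  rw [norm_block_zero_right, abs_mul, abs_of_nonneg hc]
  exact mul_le_mul_of_nonneg_left (abs_inl_le ξ) hc

lemma norm_toLp_criticVectorAt_le (M : CMDP S A) (hφ : ∀ s, ‖φ g s‖ ≤ 1) (hc : 0 ≤ cγ)
    (z : Transition S A) :
    ‖(WithLp.toLp 2 (M.criticVectorAt φ cγ g z) : CriticSpace m)‖ ≤ cγ + 1 := by
  rw [toLp_criticVectorAt]
  refine norm_add_le_of_le ?_ ?_
  · rw [norm_block_zero_right, abs_mul, abs_of_nonneg hc]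
    exact mul_le_of_le_one_right hc (M.abs_signal_le g _ _)
  · rw [norm_block_zero_left, norm_smul]
    exact mul_le_one₀ (M.abs_signal_le g _ _) (norm_nonneg _) (hφ _)

end OneSample

namespace CMDP

variable {S A : Type*} [Fintype S] [Fintype A] {m : ℕ} (M : CMDP S A)
  (φ : Signal → S → EuclideanSpace ℝ (Fin m)) (cγ : ℝ) (π : S → PMF A) (g : Signal)

lemma toEuclideanCLM_criticMatrix :
    Matrix.toEuclideanCLM (𝕜 := ℝ) (M.criticMatrix φ cγ π g) =
      M.stationaryMean π (criticOpAt φ cγ g) :=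
  M.map_stationaryMean π
    (Matrix.toEuclideanCLM (𝕜 := ℝ) (n := Unit ⊕ Fin m)).toAlgEquiv.toLinearMap
    (criticMatrixAt φ cγ g)

lemma toLp_criticVector :
    (WithLp.toLp 2 (M.criticVector φ cγ π g) : CriticSpace m) = M.stationaryMean π fun z =>
      WithLp.toLp 2 (M.criticVectorAt φ cγ g z) :=
  M.map_stationaryMean π (WithLp.linearEquiv 2 ℝ (Unit ⊕ Fin m → ℝ)).symm.toLinearMap
    (M.criticVectorAt φ cγ g)

lemma stationaryMean_criticOpAt_apply (ξ : CriticSpace m) :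
    M.stationaryMean π (criticOpAt φ cγ g) ξ =
      M.stationaryMean π fun z => criticOpAt φ cγ g z ξ :=
  M.map_stationaryMean π
    (ContinuousLinearMap.apply ℝ (CriticSpace m) ξ : _ →L[ℝ] CriticSpace m).toLinearMap
    (criticOpAt φ cγ g)

/-- The conditions under which `A_g` is coercive: bounded features, positivity of the value block,
and a constant `c_γ` large enough to dominate the off-diagonal block. -/
structure CriticRegular (lam : ℝ) : Prop where
  lam_pos : 0 < lam
  norm_feature_le : ∀ s, ‖φ g s‖ ≤ 1
  le_stationaryMean : ∀ ζ : EuclideanSpace ℝ (Fin m), lam * ‖ζ‖ ^ 2 ≤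
    M.stationaryMean π fun z => inner ℝ ζ (φ g z.1) * inner ℝ ζ (φ g z.1 - φ g z.2.2)
  le_cγ : lam + 1 / lam ≤ cγ

variable {M φ} in
lemma CriticPositive.le_stationaryMean {d : ℕ} {π : ParamSpace d → S → PMF A}
    {Θ : Set (ParamSpace d)} {lam : ℝ} (h : M.CriticPositive φ π Θ lam) {θ : ParamSpace d}
    (hθ : θ ∈ Θ) (ζ : EuclideanSpace ℝ (Fin m)) :
    lam * ‖ζ‖ ^ 2 ≤ M.stationaryMean (π θ) fun z =>
      inner ℝ ζ (φ g z.1) * inner ℝ ζ (φ g z.1 - φ g z.2.2) := by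
  have hform := M.map_stationaryMean (π θ)
    ((dotProductBilin ℝ ℝ (fun i => ζ i)) ∘ₗ (Matrix.mulVecBilin ℝ ℝ).flip (fun i => ζ i))
    (fun z : Transition S A =>
      Matrix.vecMulVec (fun i => φ g z.1 i) (fun j => φ g z.1 j - φ g z.2.2 j))
  have hsample : ∀ z : Transition S A, (fun i => ζ i) ⬝ᵥ
      (Matrix.vecMulVec (fun i => φ g z.1 i) (fun j => φ g z.1 j - φ g z.2.2 j) *ᵥ
        (fun i => ζ i)) = inner ℝ ζ (φ g z.1) * inner ℝ ζ (φ g z.1 - φ g z.2.2) := by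
    intro z
    rw [Matrix.vecMulVec_mulVec]
    simp [PiLp.inner_apply, dotProduct, Finset.sum_mul, mul_comm, mul_assoc]
  have hnorm : (fun i => ζ i) ⬝ᵥ (fun i => ζ i) = ‖ζ‖ ^ 2 := by
    rw [EuclideanSpace.norm_sq_eq]
    simp [dotProduct, pow_two]
  have hpos := h θ hθ g fun i => ζ i
  simp only [LinearMap.comp_apply, LinearMap.flip_apply, dotProductBilin_apply_apply,
    Matrix.mulVecBilin_apply, hsample] at hform
  rw [Matrix.sub_mulVec, dotProduct_sub, Matrix.smul_mulVec, Matrix.one_mulVec, dotProduct_smul,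
    hnorm, hform, smul_eq_mul] at hpos
  linarith

namespace CriticRegular

variable {M φ cγ π g} {lam : ℝ} (h : M.CriticRegular φ cγ π g lam)

include h

lemma cγ_pos : 0 < cγ := by
  have := h.lam_pos
  exact lt_of_lt_of_le (by positivity) h.le_cγ

lemma le_inner_stationaryMean_criticOpAt (ξ : CriticSpace m) :
    3 / 4 * lam * ‖ξ‖ ^ 2 ≤ inner ℝ ξ (M.stationaryMean π (criticOpAt φ cγ g) ξ) := by
  set η := ξ (Sum.inl ())
  set ζ := weights ξ
  have hlam := h.lam_pos
  have hmean : inner ℝ ξ (M.stationaryMean π (criticOpAt φ cγ g) ξ) = cγ * η ^ 2 +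
      (M.stationaryMean π (fun z => η * inner ℝ ζ (φ g z.1)) +
        M.stationaryMean π fun z => inner ℝ ζ (φ g z.1) * inner ℝ ζ (φ g z.1 - φ g z.2.2)) := by
    rw [M.stationaryMean_criticOpAt_apply, ← stationaryMean_add,
      ← M.stationaryMean_const π (cγ * η ^ 2), ← stationaryMean_add]
    refine (M.map_stationaryMean π (innerₛₗ ℝ ξ) _).trans ?_
    simp_rw [innerₛₗ_apply_apply, inner_criticOpAt]
    rfl
  have hcross : ‖M.stationaryMean π fun z => η * inner ℝ ζ (φ g z.1)‖ ≤ |η| * ‖ζ‖ := by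
    refine M.norm_stationaryMean_le π fun z => ?_
    rw [Real.norm_eq_abs, abs_mul]
    exact mul_le_mul_of_nonneg_left ((abs_real_inner_le_norm _ _).trans
      (mul_le_of_le_one_right (norm_nonneg _) (h.norm_feature_le _))) (abs_nonneg _)
  have hAMGM : |η| * ‖ζ‖ ≤ 1 / lam * η ^ 2 + lam / 4 * ‖ζ‖ ^ 2 := by
    have : 1 / lam * η ^ 2 + lam / 4 * ‖ζ‖ ^ 2 - |η| * ‖ζ‖ =
        (2 * |η| - lam * ‖ζ‖) ^ 2 / (4 * lam) := by
      rw [← sq_abs η]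
      field_simp
      ring
    linarith [div_nonneg (sq_nonneg (2 * |η| - lam * ‖ζ‖)) (by positivity : 0 ≤ 4 * lam)]
  rw [hmean, norm_sq_eq_add]
  rw [Real.norm_eq_abs] at hcross
  have hη : 0 ≤ lam * η ^ 2 := by positivity
  nlinarith [(abs_le.1 hcross).1, h.le_stationaryMean ζ,
    mul_le_mul_of_nonneg_right h.le_cγ (sq_nonneg η)]

lemma isUnit_det_criticMatrix : IsUnit (M.criticMatrix φ cγ π g).det := by
  rw [isUnit_iff_ne_zero]
  intro hdet
  obtain ⟨x, hx0, hx⟩ := Matrix.exists_mulVec_eq_zero_iff.2 hdet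
  have hker : M.stationaryMean π (criticOpAt φ cγ g) (WithLp.toLp 2 x) = 0 := by
    rw [← toEuclideanCLM_criticMatrix, Matrix.toEuclideanCLM_toLp, hx, WithLp.toLp_zero]
  have hcoercive := h.le_inner_stationaryMean_criticOpAt (WithLp.toLp 2 x)
  have hlam := h.lam_pos
  rw [hker, inner_zero_right] at hcoercive
  have hnorm : ‖(WithLp.toLp 2 x : CriticSpace m)‖ ^ 2 ≤ 0 :=
    nonpos_of_mul_nonpos_right hcoercive (by positivity)
  have hzero := norm_eq_zero.1 (pow_eq_zero_iff two_ne_zero |>.1 (hnorm.antisymm (sq_nonneg _)))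
  exact hx0 (congrArg WithLp.ofLp hzero)

lemma stationaryMean_criticOpAt_criticTarget :
    M.stationaryMean π (criticOpAt φ cγ g) (M.criticTarget φ cγ π g) =
      WithLp.toLp 2 (M.criticVector φ cγ π g) := by
  rw [← toEuclideanCLM_criticMatrix, criticTarget, Matrix.toEuclideanCLM_toLp,
    Matrix.mulVec_mulVec, Matrix.mul_nonsing_inv _ h.isUnit_det_criticMatrix, Matrix.one_mulVec]

lemma norm_criticTarget_le : ‖M.criticTarget φ cγ π g‖ ≤ 2 * (cγ + 1) / lam := by
  have hc := h.cγ_pos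
  have hcoercive := h.le_inner_stationaryMean_criticOpAt (M.criticTarget φ cγ π g)
  have hvec : ‖(WithLp.toLp 2 (M.criticVector φ cγ π g) : CriticSpace m)‖ ≤ cγ + 1 := by
    rw [toLp_criticVector]
    exact M.norm_stationaryMean_le π (norm_toLp_criticVectorAt_le M h.norm_feature_le hc.le)
  rw [h.stationaryMean_criticOpAt_criticTarget] at hcoercive
  have hle := hcoercive.trans (real_inner_le_norm _ _)
  rw [le_div_iff₀ h.lam_pos]
  rcases (norm_nonneg (M.criticTarget φ cγ π g)).eq_or_lt' with hzero | hpos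
  · rw [hzero]
    linarith
  · have : 3 / 4 * lam * ‖M.criticTarget φ cγ π g‖ ≤ cγ + 1 :=
      le_of_mul_le_mul_left (by nlinarith) hpos
    linarith

lemma norm_criticOpAt_sub_le (z : Transition S A) :
    ‖criticOpAt φ cγ g z - M.stationaryMean π (criticOpAt φ cγ g)‖ ≤ 6 := by
  refine ContinuousLinearMap.opNorm_le_bound _ (by norm_num) fun ξ => ?_
  have hmean : M.stationaryMean π (criticOpAt φ cγ g) ξ =
      block (cγ * ξ (Sum.inl ())) 0 + M.stationaryMean π (criticNoise φ g ξ) := by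
    rw [stationaryMean_criticOpAt_apply]
    simp_rw [criticOpAt_apply]
    rw [stationaryMean_add, stationaryMean_const]
  have hnoise := norm_criticNoise_le (A := A) h.norm_feature_le ξ
  rw [sub_apply, hmean, criticOpAt_apply, add_sub_add_left_eq_sub]
  exact (norm_sub_le_of_le (hnoise z) (M.norm_stationaryMean_le π hnoise)).trans_eq (by ring)

end CriticRegular

end CMDP

lemma LinearScheme.iterate_of_step_eq_zero {S A V : Type*} [NormedAddCommGroup V] [NormedSpace ℝ V]
    {D : LinearScheme S A V} (h : D.γ = 0) (x₀ : V) (xs : List (InnerSample S A)) :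
    D.iterate x₀ xs = x₀ := by
  have hstep : D.step = fun x _ => x := by
    ext x y
    rw [step, h, zero_smul, sub_zero]
  rw [iterate, hstep, List.foldl_fixed]

/-- A bound for the norm of the critic target. -/
def targetBound (lam cγ : ℝ) : ℝ := 2 * (cγ + 1) / lam

/-- A bound for the norm of the one-sample critic direction at the critic target. -/
def residualBound (lam cγ : ℝ) : ℝ := (cγ + 3) * targetBound lam cγ + (cγ + 1)

/-- The constant of the critic error bounds. -/
def criticConstant (lam cγ : ℝ) : ℝ :=
  targetBound lam cγ ^ 2 + residualBound lam cγ ^ 2 / lam +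
    384 / lam ^ 2 * (36 * targetBound lam cγ ^ 2 + residualBound lam cγ ^ 2)

lemma criticConstant_pos {lam cγ : ℝ} (hlam : 0 < lam) (hc : 0 < cγ) :
    0 < criticConstant lam cγ := by
  unfold criticConstant targetBound
  positivity

lemma sq_targetBound_le_criticConstant {lam : ℝ} (hlam : 0 < lam) (cγ : ℝ) :
    targetBound lam cγ ^ 2 ≤ criticConstant lam cγ := by
  rw [criticConstant, add_assoc]
  exact le_add_of_nonneg_right (by positivity)

lemma sq_residualBound_div_le_criticConstant {lam : ℝ} (hlam : 0 < lam) (cγ : ℝ) :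
    residualBound lam cγ ^ 2 / lam ≤ criticConstant lam cγ := by
  rw [criticConstant, add_right_comm]
  exact le_add_of_nonneg_left (by positivity)

lemma mul_sq_bounds_le_criticConstant {lam : ℝ} (hlam : 0 < lam) (cγ : ℝ) :
    384 / lam ^ 2 * (36 * targetBound lam cγ ^ 2 + residualBound lam cγ ^ 2) ≤
      criticConstant lam cγ :=
  le_add_of_nonneg_left (by positivity)

lemma mul_sq_residualBound_le_criticConstant {lam : ℝ} (hlam : 0 < lam) (cγ : ℝ) :
    384 / lam ^ 2 * residualBound lam cγ ^ 2 ≤ criticConstant lam cγ := by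
  refine le_trans ?_ (mul_sq_bounds_le_criticConstant hlam cγ)
  gcongr
  exact le_add_of_nonneg_left (by positivity)

lemma one_le_log_factor (T N : ℕ) : 1 ≤ (1 + Real.log T) * (1 + Real.log N) :=
  one_le_mul_of_one_le_of_one_le (le_add_of_nonneg_right (Real.log_natCast_nonneg T))
    (le_add_of_nonneg_right (Real.log_natCast_nonneg N))

namespace Algorithm

variable {S A : Type*} {m d : ℕ} (alg : Algorithm S A m d) (M : CMDP S A) (g : Signal)

/-- The critic recursion as a stochastic approximation scheme. -/
def criticScheme : LinearScheme S A (CriticSpace m) where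
  L := criticOpAt alg.φ alg.cγ g
  b z := WithLp.toLp 2 (M.criticVectorAt alg.φ alg.cγ g z)
  γ := alg.γξ
  Tmax := alg.Tmax

lemma criticIterate_eq_iterate :
    alg.criticIterate M g = (alg.criticScheme M g).iterate 0 := rfl

variable [Fintype S] [Fintype A] [DecidableEq S]

/-- The assumptions on the inputs under which the critic is analysed: those on the policy class
and the features, and the choice of `c_γ`, of the step size and of the truncation level. -/
structure CriticConditions (lam : ℝ) (Θ : Set (ParamSpace d)) (T : ℕ) : Prop where
  ergodic : M.Ergodic
  lam_pos : 0 < lam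
  le_cγ : 50 * (lam + 1 / lam) ≤ alg.cγ
  norm_feature_le : ∀ g s, ‖alg.φ g s‖ ≤ 1
  positive : M.CriticPositive alg.φ alg.π Θ lam
  one_le_T : 1 ≤ T
  one_le_H : 1 ≤ alg.H
  step_eq : alg.γξ = 2 * Real.log T / (lam * alg.H)
  step_le : alg.γξ ≤ lam / (24 * alg.cγ ^ 2 * M.tauMix alg.π Θ * Real.log alg.Tmax)
  le_Tmax : 8 * alg.cγ ^ 2 * M.tauMix alg.π Θ / lam ≤ alg.Tmax

namespace CriticConditions

variable {alg M g} {lam : ℝ} {Θ : Set (ParamSpace d)} {T : ℕ} {θ : ParamSpace d}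
  (h : alg.CriticConditions M lam Θ T)

include h

lemma criticRegular (hθ : θ ∈ Θ) (g : Signal) :
    M.CriticRegular alg.φ alg.cγ (alg.π θ) g lam where
  lam_pos := h.lam_pos
  norm_feature_le := h.norm_feature_le g
  le_stationaryMean := h.positive.le_stationaryMean g hθ
  le_cγ := by
    have := h.lam_pos
    have : 0 < lam + 1 / lam := by positivity
    linarith [h.le_cγ]

lemma fifty_mul_le_cγ : 50 * lam ≤ alg.cγ := by
  have := one_div_pos.2 h.lam_pos
  linarith [h.le_cγ]

lemma hundred_le_cγ : 100 ≤ alg.cγ := by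
  have hlam := h.lam_pos
  have hAMGM : 2 ≤ lam + 1 / lam := by
    rw [← sub_nonneg, show lam + 1 / lam - 2 = (lam - 1) ^ 2 / lam by field_simp; ring]
    positivity
  linarith [h.le_cγ]

lemma criticConstant_pos : 0 < criticConstant lam alg.cγ :=
  PDNAC.criticConstant_pos h.lam_pos (by linarith [h.hundred_le_cγ])

lemma mul_tauMix_le : 8 * alg.cγ ^ 2 * M.tauMix alg.π Θ ≤ lam * alg.Tmax := by
  have := (div_le_iff₀ h.lam_pos).1 h.le_Tmax
  linarith

lemma step_nonneg : 0 ≤ alg.γξ := by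
  rw [h.step_eq]
  have := h.lam_pos
  have := Real.log_natCast_nonneg T
  positivity

lemma step_denominator_pos (hT : 1 < T) :
    0 < 24 * alg.cγ ^ 2 * M.tauMix alg.π Θ * Real.log alg.Tmax := by
  have hlam := h.lam_pos
  have hH : (0 : ℝ) < alg.H := by exact_mod_cast h.one_le_H
  have hlog : 0 < Real.log T := Real.log_pos (by exact_mod_cast hT)
  have hstep : 0 < alg.γξ := by
    rw [h.step_eq]
    positivity
  exact (div_pos_iff_of_pos_left hlam).1 (hstep.trans_le h.step_le)

lemma tauMix_ne_zero (hT : 1 < T) : M.tauMix alg.π Θ ≠ 0 := by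
  intro hτ
  simpa [hτ] using h.step_denominator_pos hT

lemma three_le_Tmax (hT : 1 < T) : 3 ≤ alg.Tmax := by
  have hτ : (1 : ℝ) ≤ M.tauMix alg.π Θ := by
    exact_mod_cast Nat.one_le_iff_ne_zero.2 (h.tauMix_ne_zero hT)
  have hc := h.hundred_le_cγ
  have hle : 3 * lam ≤ alg.Tmax * lam := by
    nlinarith [h.mul_tauMix_le, h.fifty_mul_le_cγ, mul_le_mul_of_nonneg_left hτ (sq_nonneg alg.cγ)]
  exact_mod_cast le_of_mul_le_mul_right hle h.lam_pos

lemma isAdmissible (hT : 1 < T) (hθ : θ ∈ Θ) (g : Signal) :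
    (alg.criticScheme M g).IsAdmissible M (alg.π θ) (M.tauMix alg.π Θ)
      (M.criticTarget alg.φ alg.cγ (alg.π θ) g) lam (alg.cγ + 3) 6
      (residualBound lam alg.cγ) := by
  have hreg := h.criticRegular hθ g
  have hc := h.hundred_le_cγ
  have hτ : (0 : ℝ) ≤ M.tauMix alg.π Θ := Nat.cast_nonneg _
  have hγ := h.step_nonneg
  refine ⟨M.mixedBy_tauMix h.ergodic alg.π (h.tauMix_ne_zero hT) hθ, ?_,
    hreg.le_inner_stationaryMean_criticOpAt, norm_criticOpAt_le hreg.norm_feature_le hreg.cγ_pos.le,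
    hreg.norm_criticOpAt_sub_le, fun z => ?_, h.lam_pos, ?_, hγ, h.three_le_Tmax hT, ?_, ?_⟩
  · refine (M.stationaryMean_sub _ _ _).trans (sub_eq_zero.2 ?_)
    exact (M.stationaryMean_criticOpAt_apply _ _ _ _ _).symm.trans
      (hreg.stationaryMean_criticOpAt_criticTarget.trans (M.toLp_criticVector _ _ _ _))
  · refine norm_sub_le_of_le ((criticOpAt alg.φ alg.cγ g z).le_of_opNorm_le_of_le
      (norm_criticOpAt_le hreg.norm_feature_le hreg.cγ_pos.le z) hreg.norm_criticTarget_le) ?_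
    exact norm_toLp_criticVectorAt_le M hreg.norm_feature_le hreg.cγ_pos.le z
  · linarith [h.fifty_mul_le_cγ]
  · change 64 * 6 * (M.tauMix alg.π Θ : ℝ) ≤ lam * alg.Tmax
    nlinarith [h.mul_tauMix_le, mul_le_mul_of_nonneg_right (by nlinarith : 48 ≤ alg.cγ ^ 2) hτ]
  · have hden := h.step_denominator_pos hT
    have hstep := (le_div_iff₀ hden).1 h.step_le
    have hlog : 0 ≤ (M.tauMix alg.π Θ : ℝ) * Real.log alg.Tmax :=
      mul_nonneg hτ (Real.log_natCast_nonneg _)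
    have hconst : 16 * ((alg.cγ + 3) ^ 2 + 45 * 6 ^ 2) ≤ 24 * alg.cγ ^ 2 := by nlinarith
    change 16 * alg.γξ * (M.tauMix alg.π Θ * Real.log alg.Tmax) *
      ((alg.cγ + 3) ^ 2 + 45 * 6 ^ 2) ≤ lam
    linarith [mul_le_mul_of_nonneg_right hconst (mul_nonneg hγ hlog)]

lemma contraction_le (hT : 1 < T) (hθ : θ ∈ Θ) :
    (1 - alg.γξ * lam) ^ alg.H ≤ 1 / (T : ℝ) ^ 2 := by
  have hlam := h.lam_pos
  have hH : (0 : ℝ) < alg.H := by exact_mod_cast h.one_le_H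
  have hrate : alg.γξ * lam = 2 * Real.log T / alg.H := by
    rw [h.step_eq]
    field_simp
  have hle : alg.γξ * lam ≤ 1 := (h.isAdmissible hT hθ Signal.r).step_mul_rate_le_one
  rw [hrate] at hle ⊢
  refine (Real.one_sub_div_pow_le_exp_neg ((div_le_one hH).1 hle)).trans_eq ?_
  rw [Real.exp_neg, ← Nat.cast_two, ← Real.log_pow, Real.exp_log (by positivity), one_div]

lemma ratio_div_le : (M.tauMix alg.π Θ : ℝ) / alg.Tmax / lam ≤ 1 / 384 := by
  have hlam := h.lam_pos
  have hc := h.hundred_le_cγ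
  have hτ : (0 : ℝ) ≤ M.tauMix alg.π Θ := Nat.cast_nonneg _
  rw [div_div]
  refine div_le_of_le_mul₀ (by positivity) (by norm_num) ?_
  nlinarith [h.mul_tauMix_le, mul_le_mul_of_nonneg_right (by nlinarith : 48 ≤ alg.cγ ^ 2) hτ]

lemma errorFloor_le :
    (alg.criticScheme M g).errorFloor (M.tauMix alg.π Θ) lam (residualBound lam alg.cγ) ≤
      residualBound lam alg.cγ ^ 2 / lam * (M.tauMix alg.π Θ / alg.Tmax) +
        384 / lam ^ 2 * residualBound lam alg.cγ ^ 2 *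
          (Real.log T * Real.log alg.Tmax * (M.tauMix alg.π Θ / alg.H)) := by
  have hlam := h.lam_pos
  have hH : (0 : ℝ) < alg.H := by exact_mod_cast h.one_le_H
  have := Real.log_natCast_nonneg T
  have := Real.log_natCast_nonneg alg.Tmax
  have hbias : 128 * ((M.tauMix alg.π Θ : ℝ) / alg.Tmax / lam) ^ 2 ≤
      M.tauMix alg.π Θ / alg.Tmax / lam := by
    nlinarith [h.ratio_div_le, div_nonneg
      (div_nonneg (M.tauMix alg.π Θ).cast_nonneg (alg.Tmax.cast_nonneg (α := ℝ))) hlam.le]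
  have hvariance : 184 * (alg.γξ * (M.tauMix alg.π Θ * Real.log alg.Tmax) / lam) ≤
      384 / lam ^ 2 * (Real.log T * Real.log alg.Tmax * (M.tauMix alg.π Θ / alg.H)) := by
    calc _ = 368 / lam ^ 2 * (Real.log T * Real.log alg.Tmax * (M.tauMix alg.π Θ / alg.H)) := by
          rw [h.step_eq]
          field_simp
          ring
      _ ≤ _ := by
          gcongr
          norm_num
  refine (mul_le_mul_of_nonneg_right (add_le_add hbias hvariance) (sq_nonneg _)).trans_eq ?_
  ring

lemma errorFloor_nonneg :
    0 ≤ (alg.criticScheme M g).errorFloor (M.tauMix alg.π Θ) lam (residualBound lam alg.cγ) := by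
  have hlam := h.lam_pos
  have hγ : 0 ≤ (alg.criticScheme M g).γ := h.step_nonneg
  have := Real.log_natCast_nonneg (alg.criticScheme M g).Tmax
  rw [LinearScheme.errorFloor]
  positivity

lemma mean_norm_sub_sq_le_add_errorFloor (hθ : θ ∈ Θ) (g : Signal) (s : S) :
    mean (M.innerLaw (alg.π θ) alg.Tmax alg.H s)
        (fun xs => ‖alg.criticIterate M g xs - M.criticTarget alg.φ alg.cγ (alg.π θ) g‖ ^ 2) ≤
      1 / (T : ℝ) ^ 2 * targetBound lam alg.cγ ^ 2 +
        (alg.criticScheme M g).errorFloor (M.tauMix alg.π Θ) lam (residualBound lam alg.cγ) := by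
  have hroot := (h.criticRegular hθ g).norm_criticTarget_le
  have hroot2 := pow_le_pow_left₀ (norm_nonneg _) hroot 2
  rcases h.one_le_T.eq_or_lt with rfl | hT
  · have hγ : (alg.criticScheme M g).γ = 0 := h.step_eq.trans (by simp)
    simp_rw [criticIterate_eq_iterate, LinearScheme.iterate_of_step_eq_zero hγ, zero_sub,
      norm_neg, mean_const]
    simpa [targetBound] using le_add_of_le_of_nonneg hroot2 h.errorFloor_nonneg
  · refine ((h.isAdmissible hT hθ g).mean_norm_iterate_sub_sq_le alg.H s 0).trans
      (add_le_add_left ?_ _)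
    rw [zero_sub, norm_neg]
    exact mul_le_mul (h.contraction_le hT hθ) hroot2 (sq_nonneg _) (by positivity)

lemma norm_mean_sub_sq_le_add (hθ : θ ∈ Θ) (g : Signal) (s : S) :
    ‖mean (M.innerLaw (alg.π θ) alg.Tmax alg.H s) (alg.criticIterate M g) -
        M.criticTarget alg.φ alg.cγ (alg.π θ) g‖ ^ 2 ≤
      1 / (T : ℝ) ^ 2 * targetBound lam alg.cγ ^ 2 +
        384 * (M.tauMix alg.π Θ / alg.Tmax / lam) ^ 2 *
          (6 ^ 2 * targetBound lam alg.cγ ^ 2 + residualBound lam alg.cγ ^ 2) := by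
  have hroot := (h.criticRegular hθ g).norm_criticTarget_le
  have hroot2 := pow_le_pow_left₀ (norm_nonneg _) hroot 2
  rcases h.one_le_T.eq_or_lt with rfl | hT
  · have hγ : (alg.criticScheme M g).γ = 0 := h.step_eq.trans (by simp)
    rw [criticIterate_eq_iterate, funext (LinearScheme.iterate_of_step_eq_zero hγ 0), mean_const,
      zero_sub, norm_neg]
    refine le_add_of_le_of_nonneg ?_ (by positivity)
    simpa [targetBound] using hroot2
  · refine ((h.isAdmissible hT hθ g).norm_mean_iterate_sub_sq_le alg.H s 0).trans ?_
    rw [zero_sub, norm_neg]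
    refine add_le_add (mul_le_mul (h.contraction_le hT hθ) hroot2 (sq_nonneg _) (by positivity)) ?_
    change 384 * ((M.tauMix alg.π Θ : ℝ) / alg.Tmax / lam) ^ 2 * _ ≤ _
    gcongr
    exact hroot

theorem mean_norm_sub_sq_le (hθ : θ ∈ Θ) (g : Signal) (s : S) :
    mean (M.innerLaw (alg.π θ) alg.Tmax alg.H s)
        (fun xs => ‖alg.criticIterate M g xs - M.criticTarget alg.φ alg.cγ (alg.π θ) g‖ ^ 2) ≤
      criticConstant lam alg.cγ * ((1 + Real.log T) * (1 + Real.log alg.Tmax)) *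
        (1 / (T : ℝ) ^ 2 + M.tauMix alg.π Θ / alg.H + M.tauMix alg.π Θ / alg.Tmax) := by
  have hlam := h.lam_pos
  have := Real.log_natCast_nonneg T
  have := Real.log_natCast_nonneg alg.Tmax
  have hL := one_le_log_factor T alg.Tmax
  have hlog : Real.log T * Real.log alg.Tmax ≤
      (1 + Real.log T) * (1 + Real.log alg.Tmax) := by gcongr <;> linarith
  have hC := le_mul_of_one_le_right (h.criticConstant_pos).le hL
  have htarget := (sq_targetBound_le_criticConstant hlam alg.cγ).trans hC
  have hresidual := (sq_residualBound_div_le_criticConstant hlam alg.cγ).trans hC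
  calc _ ≤ _ := (h.mean_norm_sub_sq_le_add_errorFloor hθ g s).trans
        (add_le_add_right h.errorFloor_le _)
    _ ≤ 1 / (T : ℝ) ^ 2 *
            (criticConstant lam alg.cγ * ((1 + Real.log T) * (1 + Real.log alg.Tmax))) +
          (criticConstant lam alg.cγ * ((1 + Real.log T) * (1 + Real.log alg.Tmax)) *
              (M.tauMix alg.π Θ / alg.Tmax) +
            criticConstant lam alg.cγ * ((1 + Real.log T) * (1 + Real.log alg.Tmax) *
              (M.tauMix alg.π Θ / alg.H))) := by
        gcongr
        · exact h.criticConstant_pos.le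
        · exact mul_sq_residualBound_le_criticConstant hlam alg.cγ
    _ = _ := by ring

theorem norm_mean_sub_sq_le (hθ : θ ∈ Θ) (g : Signal) (s : S) :
    ‖mean (M.innerLaw (alg.π θ) alg.Tmax alg.H s) (alg.criticIterate M g) -
        M.criticTarget alg.φ alg.cγ (alg.π θ) g‖ ^ 2 ≤
      criticConstant lam alg.cγ * ((1 + Real.log T) * (1 + Real.log alg.Tmax)) *
        (1 / (T : ℝ) ^ 2 + M.tauMix alg.π Θ ^ 2 / alg.Tmax) := by
  refine (h.norm_mean_sub_sq_le_add hθ g s).trans ?_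
  have hlam := h.lam_pos
  have hL := one_le_log_factor T alg.Tmax
  have hratio : ((M.tauMix alg.π Θ : ℝ) / alg.Tmax) ^ 2 ≤ M.tauMix alg.π Θ ^ 2 / alg.Tmax := by
    rw [div_pow]
    rcases alg.Tmax.eq_zero_or_pos with hzero | hpos
    · simp [hzero]
    · have hone : (1 : ℝ) ≤ alg.Tmax := by exact_mod_cast hpos
      gcongr
      exact le_self_pow₀ hone two_ne_zero
  have hC := le_mul_of_one_le_right h.criticConstant_pos.le hL
  calc _ = 1 / (T : ℝ) ^ 2 * targetBound lam alg.cγ ^ 2 +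
          384 / lam ^ 2 * (36 * targetBound lam alg.cγ ^ 2 + residualBound lam alg.cγ ^ 2) *
            ((M.tauMix alg.π Θ : ℝ) / alg.Tmax) ^ 2 := by ring
    _ ≤ 1 / (T : ℝ) ^ 2 *
            (criticConstant lam alg.cγ * ((1 + Real.log T) * (1 + Real.log alg.Tmax))) +
          criticConstant lam alg.cγ * ((1 + Real.log T) * (1 + Real.log alg.Tmax)) *
            (M.tauMix alg.π Θ ^ 2 / alg.Tmax) := by
        have hCL := h.criticConstant_pos.le.trans hC
        exact add_le_add
          (mul_le_mul_of_nonneg_left ((sq_targetBound_le_criticConstant hlam _).trans hC)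
            (by positivity))
          (mul_le_mul ((mul_sq_bounds_le_criticConstant hlam _).trans hC) hratio (sq_nonneg _) hCL)
    _ = _ := by ring

end CriticConditions

end Algorithm

/-! ### Conditioning on the history -/

section Run

lemma bind_congr_support {α β : Type*} {p : PMF α} {f g : α → PMF β}
    (h : ∀ a ∈ p.support, f a = g a) : p.bind f = p.bind g := by
  ext b
  rw [PMF.bind_apply, PMF.bind_apply]
  refine tsum_congr fun a => ?_
  by_cases ha : p a = 0
  · simp [ha]
  · rw [h a ((p.mem_support_iff a).2 ha)]

lemma ae_toMeasure_iff {α : Type*} [MeasurableSpace α] [DiscreteMeasurableSpace α] {p : PMF α}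
    {P : α → Prop} : (∀ᵐ a ∂p.toMeasure, P a) ↔ ∀ a ∈ p.support, P a := by
  rw [ae_iff, PMF.toMeasure_apply_eq_zero_iff _ MeasurableSet.of_discrete, Set.disjoint_left]
  simp

variable {S A : Type*}

instance : DiscreteMeasurableSpace (Run S A) := ⟨fun _ => trivial⟩

/-- The part of a run before epoch `k`, which generates `history S A k`. -/
def runPrefix (k : ℕ) (ω : Run S A) : Run S A := (ω.1, ω.2.take k)

/-- The data of epoch `k`, empty when the run has no such epoch. -/
def epochData (k : ℕ) (ω : Run S A) : EpochSample S A := ω.2.getD k ([], [])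

/-- The run followed by one more epoch. -/
def runSnoc (ω : Run S A) (e : EpochSample S A) : Run S A := (ω.1, ω.2 ++ [e])

lemma runPrefix_runSnoc {k : ℕ} {ω : Run S A} (h : k ≤ ω.2.length) (e : EpochSample S A) :
    runPrefix k (runSnoc ω e) = runPrefix k ω :=
  Prod.ext rfl (List.take_append_of_le_length h)

lemma runPrefix_length (ω : Run S A) : runPrefix ω.2.length ω = ω :=
  Prod.ext rfl List.take_length

lemma epochData_runSnoc_of_lt {k : ℕ} {ω : Run S A} (h : k < ω.2.length) (e : EpochSample S A) :
    epochData k (runSnoc ω e) = epochData k ω :=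
  List.getD_append _ _ _ _ h

lemma epochData_runSnoc_length (ω : Run S A) (e : EpochSample S A) :
    epochData ω.2.length (runSnoc ω e) = e := by
  simp [epochData, runSnoc]

namespace Algorithm

variable {m d : ℕ} (alg : Algorithm S A m d) (M : CMDP S A)

lemma epochLaw_map_fst (x : EpochState S d) :
    (alg.epochLaw M x).map Prod.fst = M.innerLaw (alg.π x.θ) alg.Tmax alg.H x.state := by
  simp only [epochLaw, PMF.map_bind, PMF.map_comp, Function.comp_def]
  exact (congrArg _ (funext fun cs => PMF.map_const _ cs)).trans (PMF.bind_pure _)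

/-- The law of the epoch that follows the run `ω`. -/
def epochKernel (ω : Run S A) : PMF (EpochSample S A) :=
  alg.epochLaw M (alg.stateAfter M ω.1 ω.2)

lemma runLaw_succ (k : ℕ) : alg.runLaw M (k + 1) =
    (alg.runLaw M k).bind fun ω => (alg.epochKernel M ω).map (runSnoc ω) := rfl

lemma length_of_mem_support_runLaw (k : ℕ) {ω : Run S A} (h : ω ∈ (alg.runLaw M k).support) :
    ω.2.length = k := by
  induction k generalizing ω with
  | zero =>
    obtain ⟨s, -, rfl⟩ := (PMF.mem_support_map_iff (fun s => (s, [])) _ _).1 h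
    rfl
  | succ k ih =>
    simp only [runLaw_succ, PMF.mem_support_bind_iff, PMF.mem_support_map_iff] at h
    obtain ⟨ω', hω', e, -, rfl⟩ := h
    simp [runSnoc, ih hω']

lemma runLaw_map_runPrefix_epochData {k K : ℕ} (hk : k < K) :
    (alg.runLaw M K).map (fun ω => (runPrefix k ω, epochData k ω)) =
      (alg.runLaw M k).bind fun ω => (alg.epochKernel M ω).map (Prod.mk ω) := by
  induction K, Nat.succ_le_of_lt hk using Nat.le_induction with
  | base =>
    rw [Nat.succ_eq_add_one, runLaw_succ, PMF.map_bind]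
    refine bind_congr_support fun ω hω => ?_
    obtain rfl := alg.length_of_mem_support_runLaw M k hω
    rw [PMF.map_comp]
    congr 1
    ext1 e
    rw [Function.comp_apply, runPrefix_runSnoc le_rfl, runPrefix_length, epochData_runSnoc_length]
  | succ K hK ih =>
    rw [runLaw_succ, PMF.map_bind, ← ih hK, PMF.map]
    refine bind_congr_support fun ω hω => ?_
    have hlt : k < ω.2.length := hK.trans_eq (alg.length_of_mem_support_runLaw M K hω).symm
    rw [PMF.map_comp]
    simp only [Function.comp_def, runPrefix_runSnoc hlt.le, epochData_runSnoc_of_lt hlt]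
    exact PMF.map_const _ _

variable {alg M}

lemma mem_support_of_mem_support_runLaw {k K : ℕ} (hk : k < K) {ω : Run S A}
    (hω : ω ∈ (alg.runLaw M K).support) :
    runPrefix k ω ∈ (alg.runLaw M k).support ∧
      epochData k ω ∈ (alg.epochKernel M (runPrefix k ω)).support := by
  have hmem : (runPrefix k ω, epochData k ω) ∈
      ((alg.runLaw M K).map fun ω => (runPrefix k ω, epochData k ω)).support :=
    (PMF.mem_support_map_iff _ _ _).2 ⟨ω, hω, rfl⟩
  rw [alg.runLaw_map_runPrefix_epochData M hk] at hmem
  simp only [PMF.mem_support_bind_iff, PMF.mem_support_map_iff, Prod.mk.injEq] at hmem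
  obtain ⟨ω', hω', e, he, rfl, rfl⟩ := hmem
  exact ⟨hω', he⟩

lemma length_fst_epochData {k K : ℕ} (hk : k < K) {ω : Run S A}
    (hω : ω ∈ (alg.runLaw M K).support) : (epochData k ω).1.length = alg.H := by
  have hmem := (PMF.mem_support_map_iff Prod.fst _ _).2
    ⟨_, (mem_support_of_mem_support_runLaw hk hω).2, rfl⟩
  rw [epochKernel, epochLaw_map_fst] at hmem
  exact M.length_of_mem_support_innerLaw _ _ _ _ hmem

section CondExp

variable {V : Type*} [NormedAddCommGroup V] {k K : ℕ} {Ψ : Run S A → EpochSample S A → V}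

lemma bddOn_bind_epochKernel (hk : k < K)
    (hb : BddOn (alg.runLaw M K) fun ω => Ψ (runPrefix k ω) (epochData k ω)) :
    BddOn ((alg.runLaw M k).bind fun ω => (alg.epochKernel M ω).map (Prod.mk ω))
      (Function.uncurry Ψ) := by
  rw [← alg.runLaw_map_runPrefix_epochData M hk]
  exact BddOn.map hb

lemma bddOn_epochKernel (hk : k < K)
    (hb : BddOn (alg.runLaw M K) fun ω => Ψ (runPrefix k ω) (epochData k ω)) {ω : Run S A}
    (hω : ω ∈ (alg.runLaw M k).support) : BddOn (alg.epochKernel M ω) (Ψ ω) :=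
  ((bddOn_bind_epochKernel hk hb).of_bind hω).of_map

variable [NormedSpace ℝ V]

lemma bddOn_mean_epochKernel (hk : k < K)
    (hb : BddOn (alg.runLaw M K) fun ω => Ψ (runPrefix k ω) (epochData k ω)) :
    BddOn (alg.runLaw M K) fun ω =>
      mean (alg.epochKernel M (runPrefix k ω)) (Ψ (runPrefix k ω)) := by
  obtain ⟨C, hC⟩ := bddOn_bind_epochKernel hk hb
  refine ⟨C, fun ω hω => norm_mean_le fun e he => hC (runPrefix k ω, e) ?_⟩
  simp only [PMF.mem_support_bind_iff, PMF.mem_support_map_iff]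
  exact ⟨_, (mem_support_of_mem_support_runLaw hk hω).1, e, he, rfl⟩

variable [CompleteSpace V]

lemma mean_runLaw_eq_mean_epochKernel (hk : k < K)
    (hb : BddOn (alg.runLaw M K) fun ω => Ψ (runPrefix k ω) (epochData k ω)) :
    mean (alg.runLaw M K) (fun ω => Ψ (runPrefix k ω) (epochData k ω)) =
      mean (alg.runLaw M k) fun ω => mean (alg.epochKernel M ω) (Ψ ω) := by
  have hbind := bddOn_bind_epochKernel hk hb
  calc _ = mean ((alg.runLaw M K).map fun ω => (runPrefix k ω, epochData k ω))
        (Function.uncurry Ψ) := (mean_map (f := Function.uncurry Ψ) hb).symm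
    _ = _ := by
        rw [alg.runLaw_map_runPrefix_epochData M hk, mean_bind hbind]
        exact mean_congr fun ω hω => mean_map (hbind.of_bind hω).of_map

lemma mean_indicator_mean_epochKernel (hk : k < K)
    (hb : BddOn (alg.runLaw M K) fun ω => Ψ (runPrefix k ω) (epochData k ω)) (B : Set (Run S A)) :
    mean (alg.runLaw M K) ((runPrefix k ⁻¹' B).indicator fun ω =>
        mean (alg.epochKernel M (runPrefix k ω)) (Ψ (runPrefix k ω))) =
      mean (alg.runLaw M K)
        ((runPrefix k ⁻¹' B).indicator fun ω => Ψ (runPrefix k ω) (epochData k ω)) := by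
  let avg : Run S A → EpochSample S A → V := fun ω _ =>
    B.indicator (fun ω => mean (alg.epochKernel M ω) (Ψ ω)) ω
  let val : Run S A → EpochSample S A → V := fun ω e => B.indicator (fun ω => Ψ ω e) ω
  have havg := mean_runLaw_eq_mean_epochKernel (Ψ := avg) hk
    ((bddOn_mean_epochKernel hk hb).indicator _)
  have hval := mean_runLaw_eq_mean_epochKernel (Ψ := val) hk (hb.indicator _)
  refine havg.trans ((mean_congr fun ω _ => ?_).trans hval.symm)
  by_cases hω : ω ∈ B <;> simp [avg, val, hω, mean_const]

theorem condExp_history [SecondCountableTopology V] (hk : k < K)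
    (hb : BddOn (alg.runLaw M K) fun ω => Ψ (runPrefix k ω) (epochData k ω)) :
    (alg.runMeasure M K)[fun ω => Ψ (runPrefix k ω) (epochData k ω) | history S A k]
      =ᵐ[alg.runMeasure M K] fun ω =>
        mean (alg.epochKernel M (runPrefix k ω)) (Ψ (runPrefix k ω)) := by
  have hm : history S A k ≤ (inferInstance : MeasurableSpace (Run S A)) := fun _ _ => trivial
  have hprob : IsProbabilityMeasure (alg.runMeasure M K) := PMF.toMeasure.isProbabilityMeasure _
  have hmean := bddOn_mean_epochKernel hk hb
  symm
  refine ae_eq_condExp_of_forall_setIntegral_eq hm (integrable_toMeasure hb)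
    (fun s _ _ => (integrable_toMeasure hmean).integrableOn) (fun s hs _ => ?_) ?_
  · obtain ⟨B, -, rfl⟩ := hs
    rw [← integral_indicator MeasurableSet.of_discrete,
      ← integral_indicator MeasurableSet.of_discrete, runMeasure,
      integral_toMeasure (hmean.indicator _), integral_toMeasure (hb.indicator _)]
    exact mean_indicator_mean_epochKernel hk hb B
  · borelize V
    have hmeas : Measurable[history S A k] fun ω : Run S A =>
        mean (alg.epochKernel M (runPrefix k ω)) (Ψ (runPrefix k ω)) :=
      (measurable_from_top (f := fun ω => mean (alg.epochKernel M ω) (Ψ ω))).comp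
        (comap_measurable (runPrefix k))
    exact hmeas.stronglyMeasurable.aestronglyMeasurable

lemma condExp_critic_history [SecondCountableTopology V] (hk : k < K)
    {Φ : ParamSpace d → List (InnerSample S A) → V}
    (hb : BddOn (alg.runLaw M K) fun ω => Φ (alg.theta M k ω) (epochData k ω).1) :
    (alg.runMeasure M K)[fun ω => Φ (alg.theta M k ω) (epochData k ω).1 | history S A k]
      =ᵐ[alg.runMeasure M K] fun ω =>
        mean (M.innerLaw (alg.π (alg.theta M k ω)) alg.Tmax alg.H
          (alg.stateAfter M ω.1 (ω.2.take k)).state) (Φ (alg.theta M k ω)) := by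
  let Ψ : Run S A → EpochSample S A → V := fun ω e => Φ (alg.stateAfter M ω.1 ω.2).θ e.1
  have hprefix : ∀ᵐ ω ∂alg.runMeasure M K, runPrefix k ω ∈ (alg.runLaw M k).support :=
    ae_toMeasure_iff.2 fun ω hω => (mem_support_of_mem_support_runLaw hk hω).1
  filter_upwards [condExp_history (Ψ := Ψ) hk hb, hprefix] with ω hω hmem
  refine hω.trans ((mean_map (bddOn_epochKernel (Ψ := Ψ) hk hb hmem)).symm.trans ?_)
  rw [epochKernel, epochLaw_map_fst]
  rfl

end CondExp

section Critic

variable {k K : ℕ}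

lemma bddOn_xi [Finite S] [Finite A] (hk : k < K) (g : Signal) :
    BddOn (alg.runLaw M K) (alg.xi M g k) := by
  obtain ⟨C, hC⟩ := (alg.criticScheme M g).exists_norm_iterate_le 0 alg.H
  exact ⟨C, fun ω hω => hC _ (length_fst_epochData hk hω)⟩

lemma CriticConditions.bddOn_criticTarget_theta [Fintype S] [Fintype A] [DecidableEq S] {lam : ℝ}
    {Θ : Set (ParamSpace d)} {T : ℕ} (h : alg.CriticConditions M lam Θ T)
    (hΘ : ∀ᵐ ω ∂alg.runMeasure M K, alg.theta M k ω ∈ Θ) (g : Signal) :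
    BddOn (alg.runLaw M K)
      fun ω => M.criticTarget alg.φ alg.cγ (alg.π (alg.theta M k ω)) g :=
  ⟨_, fun ω hω => (h.criticRegular (ae_toMeasure_iff.1 hΘ ω hω) g).norm_criticTarget_le⟩

end Critic

end Algorithm

end Run

end PDNAC

end

theorem mainTheorem4 :
    ∃ (p : ℕ) (κ : ℝ), ∀ lam cγ : ℝ, 0 < lam → κ * (lam + 1 / lam) ≤ cγ → ∃ C : ℝ, 0 < C ∧
      ∀ (S : Type*) (A : Type*) [Fintype S] [DecidableEq S] [Fintype A]
        (M : PDNAC.CMDP S A) (m d : ℕ) (alg : PDNAC.Algorithm S A m d)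
        (Θ : Set (PDNAC.ParamSpace d)) (K T : ℕ),
        M.Ergodic →
        (∀ g s, ‖alg.φ g s‖ ≤ 1) →
        M.CriticPositive alg.φ alg.π Θ lam →
        (∀ k < K, ∀ᵐ ω ∂alg.runMeasure M K, alg.theta M k ω ∈ Θ) →
        alg.cγ = cγ →
        alg.δ ∈ Set.Ioo (0 : ℝ) 1 →
        1 ≤ T →
        1 ≤ alg.H →
        alg.γξ = 2 * Real.log T / (lam * alg.H) →
        alg.γξ ≤ lam / (24 * cγ ^ 2 * M.tauMix alg.π Θ * Real.log alg.Tmax) →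
        8 * cγ ^ 2 * M.tauMix alg.π Θ / lam ≤ alg.Tmax →
        ∀ (g : PDNAC.Signal) (k : ℕ), k < K →
          (∀ θ ∈ Θ, IsUnit (M.criticMatrix alg.φ alg.cγ (alg.π θ) g).det) ∧
          Integrable (alg.xi M g k) (alg.runMeasure M K) ∧
          Integrable (fun ω => ‖alg.xi M g k ω -
            M.criticTarget alg.φ alg.cγ (alg.π (alg.theta M k ω)) g‖ ^ 2)
            (alg.runMeasure M K) ∧
          (∀ᵐ ω ∂alg.runMeasure M K,
            ‖((alg.runMeasure M K)[alg.xi M g k | PDNAC.history S A k]) ω -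
                M.criticTarget alg.φ alg.cγ (alg.π (alg.theta M k ω)) g‖ ^ 2 ≤
              C * ((1 + Real.log T) * (1 + Real.log alg.Tmax)) ^ p *
                (1 / (T : ℝ) ^ 2 + (M.tauMix alg.π Θ : ℝ) ^ 2 / alg.Tmax)) ∧
          (∀ᵐ ω ∂alg.runMeasure M K,
            ((alg.runMeasure M K)[fun ω => ‖alg.xi M g k ω -
                M.criticTarget alg.φ alg.cγ (alg.π (alg.theta M k ω)) g‖ ^ 2 |
                PDNAC.history S A k]) ω ≤
              C * ((1 + Real.log T) * (1 + Real.log alg.Tmax)) ^ p *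
                (1 / (T : ℝ) ^ 2 + (M.tauMix alg.π Θ : ℝ) / alg.H +
                  (M.tauMix alg.π Θ : ℝ) / alg.Tmax)) := by
  open PDNAC in
  refine ⟨1, 50, fun lam cγ hlam hlarge => ⟨criticConstant lam cγ, criticConstant_pos hlam ?_, ?_⟩⟩
  · exact lt_of_lt_of_le (by positivity) hlarge
  intro S A _ _ _ M m d alg Θ K T hM hφ hpos hΘ hcγ _ hT hH hγ hγle hTmax g k hk
  subst hcγ
  have h : alg.CriticConditions M lam Θ T :=
    ⟨hM, hlam, hlarge, hφ, hpos, hT, hH, hγ, hγle, hTmax⟩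
  have hξ := Algorithm.bddOn_xi (alg := alg) (M := M) hk g
  have herror := (hξ.sub (h.bddOn_criticTarget_theta (hΘ k hk) g)).norm_sq
  refine ⟨fun θ hθ => (h.criticRegular hθ g).isUnit_det_criticMatrix, integrable_toMeasure hξ,
    integrable_toMeasure herror, ?_, ?_⟩
  · filter_upwards [Algorithm.condExp_critic_history (Φ := fun _ => alg.criticIterate M g) hk hξ,
      hΘ k hk] with ω hω hθ
    rw [pow_one]
    exact (congrArg (fun ξ => ‖ξ - _‖ ^ 2) hω).trans_le (h.norm_mean_sub_sq_le hθ g _)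
  · filter_upwards [Algorithm.condExp_critic_history (Φ := fun θ xs =>
      ‖alg.criticIterate M g xs - M.criticTarget alg.φ alg.cγ (alg.π θ) g‖ ^ 2) hk herror,
      hΘ k hk] with ω hω hθ
    rw [pow_one]
    exact hω.trans_le (h.mean_norm_sub_sq_le hθ g _)
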